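/- Let $\mathbb K$ be a field, let $N\ge 0$, and let $A=\mathbb K[X_1][X_2;\sigma_2,\delta_2]\cdots[X_N;\sigma_N,\delta_N]$ be an iterated Ore extension with $\mathbb K$-algebra automorphisms $\sigma_i$ and $\mathbb K$-linear $\sigma_i$-derivations $\delta_i$ of $A_{i-1}=\mathbb K\langle X_1,\dots,X_{i-1}\rangle$. Suppose the following. * There is a matrix $(\lambda_{i,l})\in M_N(\mathbb K^*)$ with $\lambda_{i,l}=\lambda_{l,i}^{-1}$ for all $i,l$, and $\sigma_i(X_l)=\lambda_{i,l}X_l$ for $l<i$. * For each $2\le i\le N$ there are $1\ne q_i\in\mathbb K^*$ with $\delta_i\sigma_i=q_i\sigma_i\delta_i$, and $\mathbb K$-linear operators $(d_{i,n})_{n\ge0}$ of $A_{i-1}$ with $d_{i,0}=\mathrm{id}$, $d_{i,1}=\delta_i$, $d_{i,n}(rs)=\sum_{m=0}^n\sigma_i^{n-m}d_{i,m}(r)\,d_{i,n-m}(s)$, $d_{i,n}\sigma_i=q_i^n\sigma_id_{i,n}$, and $d_{i,n}d_{i,m}=\binom{n+m}{m}_{q_i}d_{i,n+m}$ (Gaussian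 binomials). For each $r\in A_{i-1}$, $d_{i,n}(r)=0$ for all large $n$. Finally $\sigma_l d_{i,n}=\lambda_{l,i}^n d_{i,n}\sigma_l$ on $A_{i-1}$ for all $n$ and $i<l\le N$. Define elements $X^{(j)}_1,\dots,X^{(j)}_N$ of the division ring of fractions $\mathrm{Frac}(A)$ for $j=N+1,N,\dots,2$ by $X^{(N+1)}_l=X_l$ and, writing $x_l=X^{(j+1)}_l$ and $y_l=X_l^{(j)}$, $$y_l=\sum_{n\ge0}q_j^{n(n+1)/2}(q_j-1)^{-n}\,d_{j,n}\bigl(\sigma_j^{-n}(x_l)\bigr)\,x_j^{-n}\quad(l<j),\qquad y_l=x_l\quad(l\ge j),$$ where $\sigma_j,d_{j,n}$ act on $\mathbb K\langle x_1,\dots,x_{j-1}\rangle$ through the algebra isomorphism with $A_{j-1}$ that sends $x_i$ to $X_i$. Put $A^{(j)}=\mathbb K\langle X_1^{(j)},\dots,X_N^{(j)}\rangle\subseteq\mathrm{Frac}(A)$, $A'=A^{(2)}$ and $T_i=X_i^{(2)}$ (for $N=0$: $A'=A$). For a ring $R$ let $\mathrm{C.Spec}(R)$ be the set of completely prime ideals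 of $R$ (proper two-sided ideals with quotient a domain). For $P\in\mathrm{C.Spec}(A^{(j+1)})$ put $\psi_j(P)=\{p\,x_j^{-n}: p\in P,\ n\ge0\}\cap A^{(j)}$ if $x_j\notin P$, and $\psi_j(P)=g_j^{-1}(P/\langle x_j\rangle)$ if $x_j\in P$, where $g_j:A^{(j)}\to A^{(j+1)}/\langle x_j\rangle$ is the algebra homomorphism with $g_j(y_i)=x_i+\langle x_j\rangle$ for all $i$. Let $\psi=\psi_2\circ\cdots\circ\psi_N$. For $w\subseteq\{1,\dots,N\}$ let $$\mathrm{C.Spec}_w(A')=\{Q\in\mathrm{C.Spec}(A')\mid Q\cap\{T_1,\dots,T_N\}=\{T_i\mid i\in w\}\},\qquad \mathrm{C.Spec}_w(A)=\psi^{-1}(\mathrm{C.Spec}_w(A')).$$ Let $\mathcal W$ be the power set of $\{1,\dots,N\}$, and let $\mathcal W'$ be the set of those $w\in\mathcal W$ (the Cauchon diagrams of $A$) for which $\mathrm{C.Spec}_w(A)\ne\emptyset$. Then $\psi$ is a map $\mathrm{C.Spec}(A)\to\mathrm{C.Spec}(A')$, and the sets $\mathrm{C.Spec}_w(A)$, $w\in\mathcal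 W'$, are nonempty, pairwise disjoint and cover $\mathrm{C.Spec}(A)$: $$\mathrm{C.Spec}(A)=\bigsqcup_{w\in\mathcal W'}\mathrm{C.Spec}_w(A),\qquad |\mathcal W'|\le|\mathcal W|=2^N.$$ -/

import Mathlib

open scoped nonZeroDivisors

section Gaussian

/-- The Gaussian binomial coefficient `binom(n, k)_q`, as the value at `q` of a polynomial with
integer coefficients, through the `q`-Pascal recursion. -/
def qBinom {R : Type*} [Semiring R] (q : R) : ℕ → ℕ → R
  | _, 0 => 1
  | 0, _ + 1 => 0
  | n + 1, k + 1 => qBinom q n k + q ^ (k + 1) * qBinom q n (k + 1)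

/-- The `q`-factorial `(n)!_q = (1)_q ⋯ (n)_q`, where `(i)_q = 1 + q + ⋯ + q ^ (i - 1)`. -/
def qFactorial {R : Type*} [Semiring R] (q : R) : ℕ → R
  | 0 => 1
  | n + 1 => qFactorial q n * ∑ j ∈ Finset.range (n + 1), q ^ j

theorem qBinom_eq_zero {R : Type*} [Semiring R] (q : R) (n k : ℕ) (h : n < k) :
    qBinom q n k = 0 := by
  induction n generalizing k with
  | zero =>
    obtain ⟨k, rfl⟩ := Nat.exists_eq_succ_of_ne_zero (by omega : k ≠ 0)
    rfl
  | succ n ih =>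
    obtain ⟨k, rfl⟩ := Nat.exists_eq_succ_of_ne_zero (by omega : k ≠ 0)
    simp [qBinom, ih k (by omega), ih (k + 1) (by omega)]

/-- The recursion computes `(n)!_q / ((m)!_q (n - m)!_q)`. -/
theorem qBinom_mul_qFactorial {R : Type*} [CommRing R] (q : R) (n m : ℕ) :
    qBinom q (n + m) m * qFactorial q m * qFactorial q n = qFactorial q (n + m) := by
  induction hs : n + m generalizing n m with
  | zero =>
    obtain ⟨rfl, rfl⟩ : n = 0 ∧ m = 0 := by omega
    simp [qBinom, qFactorial]
  | succ s ih =>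
    rcases Nat.eq_zero_or_pos m with rfl | hm
    · obtain rfl : n = s + 1 := by omega
      simp [qBinom, qFactorial]
    obtain ⟨m, rfl⟩ := Nat.exists_eq_succ_of_ne_zero hm.ne'
    rcases Nat.eq_zero_or_pos n with rfl | hn
    · obtain rfl : m = s := by omega
      have h := ih 0 m (by omega)
      simp only [qFactorial, mul_one] at h
      simp only [qFactorial, qBinom, qBinom_eq_zero q m (m + 1) (by omega),
        mul_zero, add_zero, mul_one, ← mul_assoc, h]
    obtain ⟨n, rfl⟩ := Nat.exists_eq_succ_of_ne_zero hn.ne'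
    have h1 := ih (n + 1) m (by omega)
    have h2 := ih n (m + 1) (by omega)
    have e : ∑ j ∈ Finset.range (s + 1), q ^ j = ∑ j ∈ Finset.range (m + 1), q ^ j +
        q ^ (m + 1) * ∑ j ∈ Finset.range (n + 1), q ^ j := by
      rw [show s + 1 = (m + 1) + (n + 1) by omega, Finset.sum_range_add, Finset.mul_sum]
      simp only [pow_add]
    simp only [qBinom, qFactorial] at h1 h2 ⊢
    rw [e]
    linear_combination (∑ j ∈ Finset.range (m + 1), q ^ j) * h1 +
      (q ^ (m + 1) * ∑ j ∈ Finset.range (n + 1), q ^ j) * h2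

end Gaussian

section SkewDerivations

variable {K : Type*} [Field K] {R : Type*} [Ring R] [Algebra K R]

/-- `δ` is a (left) `σ`-derivation of the `K`-algebra `R`. -/
def IsSkewDerivation (σ : R ≃ₐ[K] R) (δ : R →ₗ[K] R) : Prop :=
  ∀ a b : R, δ (a * b) = σ a * δ b + δ a * b

/-- The pair `(σ, δ)` is `q`-skew: `q ∈ K`, `q ≠ 0, 1` and `δ ∘ σ = q σ ∘ δ`. -/
def IsQSkew (q : K) (σ : R ≃ₐ[K] R) (δ : R →ₗ[K] R) : Prop :=
  q ≠ 0 ∧ q ≠ 1 ∧ ∀ a : R, δ (σ a) = q • σ (δ a)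

/-- The sequence `d` is a higher `q`-skew `σ`-derivation of `R` that extends `δ`. -/
structure IsHigherSkewDerivation (q : K) (σ : R ≃ₐ[K] R) (δ : R →ₗ[K] R)
    (d : ℕ → R →ₗ[K] R) : Prop where
  zero : d 0 = LinearMap.id
  one : d 1 = δ
  mul : ∀ (n : ℕ) (r s : R),
    d n (r * s) = ∑ i ∈ Finset.range (n + 1), (σ ^ (n - i)) (d i r) * d (n - i) s
  skew : ∀ (n : ℕ) (r : R), d n (σ r) = q ^ n • σ (d n r)

/-- The sequence `d` of operators is locally nilpotent: each element is killed by all but finitely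
many of the `d n`. -/
def IsLocallyNilpotentSeq (d : ℕ → R →ₗ[K] R) : Prop :=
  ∀ r : R, ∃ m : ℕ, ∀ n : ℕ, m ≤ n → d n r = 0

/-- The sequence `d` is iterative: `d n ∘ d m = binom(n + m, m)_q d (n + m)`. -/
def IsIterativeSeq (q : K) (d : ℕ → R →ₗ[K] R) : Prop :=
  ∀ (n m : ℕ) (r : R), d n (d m r) = qBinom q (n + m) m • d (n + m) r

end SkewDerivations

section OreExtension

variable {K : Type*} [Field K] {A : Type*} [Ring A] [Algebra K A]

/-- Inside the `K`-algebra `A`, the subalgebra `S` is the Ore extension `R[x; σ, δ]` of the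
subalgebra `R`: it contains `R` and `x`, the powers of `x` form a basis of `S` as a left `R`-module,
`δ` is a `σ`-derivation of `R` and `x r = σ(r) x + δ(r)` for `r ∈ R`. -/
structure IsOreExtension (R S : Subalgebra K A) (x : A) (σ : R ≃ₐ[K] R) (δ : R →ₗ[K] R) :
    Prop where
  le : R ≤ S
  mem : x ∈ S
  skewDerivation : IsSkewDerivation σ δ
  comm : ∀ r : R, x * (r : A) = (σ r : A) * x + (δ r : A)
  basis : ∀ f ∈ S, ∃! c : ℕ →₀ R, f = c.sum fun n r => (r : A) * x ^ n

namespace IsOreExtension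

/-- Elements of degree less than `n`. -/
def degLT (R : Subalgebra K A) (x : A) (n : ℕ) : Submodule R A :=
  Submodule.span R ((fun i => x ^ i) '' {i : ℕ | i < n})

variable {R S : Subalgebra K A} {x : A} {σ : R ≃ₐ[K] R} {δ : R →ₗ[K] R}

theorem degLT_mono {m n : ℕ} (h : m ≤ n) : degLT R x m ≤ degLT R x n :=
  Submodule.span_mono (Set.image_mono fun _ hi => lt_of_lt_of_le hi h)

theorem degLT_smul {n : ℕ} (r : R) {f : A} (h : f ∈ degLT R x n) : (r : A) * f ∈ degLT R x n :=
  (degLT R x n).smul_mem r h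

theorem pow_mem_degLT {i n : ℕ} (h : i < n) : x ^ i ∈ degLT R x n :=
  Submodule.subset_span ⟨i, h, rfl⟩

theorem degLT_succ {n : ℕ} {f : A} (h : f ∈ degLT R x (n + 1)) :
    ∃ (a : R) (l : A), l ∈ degLT R x n ∧ f = (a : A) * x ^ n + l := by
  have e : {i : ℕ | i < n + 1} = insert n {i : ℕ | i < n} := by
    ext i
    change i < n + 1 ↔ i = n ∨ i < n
    omega
  rw [degLT, e, Set.image_insert_eq, Submodule.mem_span_insert] at h
  obtain ⟨a, l, hl, rfl⟩ := h
  exact ⟨a, l, hl, rfl⟩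

theorem degLT_zero {f : A} (h : f ∈ degLT R x 0) : f = 0 := by
  simpa [degLT] using h

theorem exists_lead {n : ℕ} {f : A} (hf : f ∈ degLT R x n) (h0 : f ≠ 0) :
    ∃ m < n, ∃ a : R, a ≠ 0 ∧ ∃ l ∈ degLT R x m, f = (a : A) * x ^ m + l := by
  induction n with
  | zero => exact absurd (degLT_zero hf) h0
  | succ n ih =>
    obtain ⟨a, l, hl, e⟩ := degLT_succ hf
    by_cases ha : a = 0
    · have : f = l := by rw [e, ha]; simp
      obtain ⟨m, hm, r⟩ := ih (this ▸ hl)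
      exact ⟨m, by omega, r⟩
    · exact ⟨n, by omega, a, ha, l, hl, e⟩

theorem degLT_le (H : IsOreExtension R S x σ δ) {n : ℕ} {f : A} (h : f ∈ degLT R x n) : f ∈ S := by
  refine Submodule.span_induction ?_ S.zero_mem (fun _ _ _ _ => S.add_mem) ?_ h
  · rintro _ ⟨i, -, rfl⟩
    exact S.pow_mem H.mem i
  · intro r f _ hf
    exact S.mul_mem (H.le r.2) hf

theorem x_mul_degLT (H : IsOreExtension R S x σ δ) {n : ℕ} {f : A} (h : f ∈ degLT R x n) : x * f ∈ degLT R x (n + 1) := by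
  refine Submodule.span_induction (p := fun f _ => x * f ∈ degLT R x (n + 1)) ?_ ?_ ?_ ?_ h
  · rintro _ ⟨i, hi, rfl⟩
    rw [← pow_succ']
    exact pow_mem_degLT (Nat.succ_lt_succ hi)
  · simp
  · intro f g _ _ hf hg
    rw [mul_add]
    exact add_mem hf hg
  · intro r f hf hxf
    have : x * (r • f) = (σ r : A) * (x * f) + (δ r : A) * f := by
      rw [Subalgebra.smul_def, smul_eq_mul, ← mul_assoc, H.comm, add_mul, mul_assoc]
    rw [this]
    exact add_mem (degLT_smul _ hxf) (degLT_smul _ (degLT_mono (Nat.le_succ n) hf))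

theorem pow_mul_degLT (H : IsOreExtension R S x σ δ) {n : ℕ} (m : ℕ) {f : A} (h : f ∈ degLT R x n) :
    x ^ m * f ∈ degLT R x (m + n) := by
  induction m with
  | zero => simpa using h
  | succ m ih =>
    rw [pow_succ', mul_assoc, show m + 1 + n = m + n + 1 by omega]
    exact H.x_mul_degLT ih

theorem pow_mul_coe (H : IsOreExtension R S x σ δ) (m : ℕ) (b : R) (k : ℕ) :
    ∃ l ∈ degLT R x (m + k), x ^ m * ((b : A) * x ^ k) = ((σ ^ m) b : A) * x ^ (m + k) + l := by
  induction m with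
  | zero => exact ⟨0, zero_mem _, by simp⟩
  | succ m ih =>
    obtain ⟨l, hl, e⟩ := ih
    refine ⟨(δ ((σ ^ m) b) : A) * x ^ (m + k) + x * l, ?_, ?_⟩
    · rw [show m + 1 + k = m + k + 1 by omega]
      exact add_mem (degLT_smul _ (pow_mem_degLT (Nat.lt_succ_self _))) (H.x_mul_degLT hl)
    · rw [pow_succ', mul_assoc, e, mul_add, ← mul_assoc, H.comm, pow_succ' σ,
        show m + 1 + k = (m + k) + 1 by omega, pow_succ' x, add_mul, AlgEquiv.mul_apply]
      simp only [mul_assoc, add_assoc]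

theorem degLT_mul (H : IsOreExtension R S x σ δ) {m k : ℕ} {f g : A} (hf : f ∈ degLT R x m) (hg : g ∈ degLT R x (k + 1)) :
    f * g ∈ degLT R x (m + k) := by
  refine Submodule.span_induction (p := fun f _ => f * g ∈ degLT R x (m + k)) ?_ ?_ ?_ ?_ hf
  · rintro _ ⟨i, hi, rfl⟩
    have hi : i < m := hi
    exact degLT_mono (by omega) (H.pow_mul_degLT i hg)
  · simp
  · intro a b _ _ ha hb
    rw [add_mul]
    exact add_mem ha hb
  · intro r a _ ha
    rw [smul_mul_assoc]
    exact Submodule.smul_mem _ _ ha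

theorem lead_mul (H : IsOreExtension R S x σ δ) {m k : ℕ} {a b : R} {l l' : A} (hl : l ∈ degLT R x m) (hl' : l' ∈ degLT R x k) :
    ∃ l'' ∈ degLT R x (m + k), ((a : A) * x ^ m + l) * ((b : A) * x ^ k + l') =
      ((a * (σ ^ m) b : R) : A) * x ^ (m + k) + l'' := by
  obtain ⟨p, hp, e⟩ := H.pow_mul_coe m b k
  refine ⟨(a : A) * p + (a : A) * (x ^ m * l') + l * ((b : A) * x ^ k + l'), ?_, ?_⟩
  · refine add_mem (add_mem (degLT_smul _ hp) (degLT_smul _ (H.pow_mul_degLT m hl'))) ?_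
    refine H.degLT_mul hl (add_mem (degLT_smul _ (pow_mem_degLT (Nat.lt_succ_self k))) ?_)
    exact degLT_mono (Nat.le_succ k) hl'
  · rw [add_mul, mul_add, mul_assoc (a : A), e]
    push_cast
    noncomm_ring

theorem exists_degLT (H : IsOreExtension R S x σ δ) {f : A} (hf : f ∈ S) : ∃ n, f ∈ degLT R x n := by
  obtain ⟨c, e, -⟩ := H.basis f hf
  refine ⟨c.support.sup id + 1, ?_⟩
  rw [e]
  refine Submodule.sum_mem _ fun i hi => degLT_smul _ (pow_mem_degLT ?_)
  exact Nat.lt_succ_of_le (Finset.le_sup (f := id) hi)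

theorem lead_ne_zero (H : IsOreExtension R S x σ δ) {m : ℕ} {a : R} (ha : a ≠ 0) {l : A} (hl : l ∈ degLT R x m) :
    (a : A) * x ^ m + l ≠ 0 := by
  have key : ∃ c : ℕ →₀ R, c m = 0 ∧ l = c.sum fun n r => (r : A) * x ^ n := by
    obtain ⟨c, hc, e⟩ := (Finsupp.mem_span_image_iff_linearCombination R).1 hl
    refine ⟨c, ?_, ?_⟩
    · by_contra h
      exact absurd (hc (Finsupp.mem_support_iff.2 h)) (lt_irrefl m)
    · rw [← e]; rfl
  obtain ⟨c, hc, e⟩ := key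
  intro h
  have h1 : (0 : A) = (Finsupp.single m a + c).sum fun n r => (r : A) * x ^ n := by
    rw [Finsupp.sum_add_index' (by simp) (by intros; simp [add_mul]), ← e,
      Finsupp.sum_single_index (by simp), h]
  have h2 := (H.basis 0 S.zero_mem).unique h1 (y₂ := 0) (by simp)
  have h3 := DFunLike.congr_fun h2 m
  simp [hc] at h3
  exact ha h3

theorem mul_ne_zero (H : IsOreExtension R S x σ δ) (hR : ∀ a b : R, a ≠ 0 → b ≠ 0 → a * b ≠ 0) {f g : A} (hf : f ∈ S) (hg : g ∈ S)
    (f0 : f ≠ 0) (g0 : g ≠ 0) : f * g ≠ 0 := by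
  obtain ⟨n, hn⟩ := H.exists_degLT hf
  obtain ⟨k, hk⟩ := H.exists_degLT hg
  obtain ⟨m, -, a, ha, l, hl, rfl⟩ := exists_lead hn f0
  obtain ⟨p, -, b, hb, l', hl', rfl⟩ := exists_lead hk g0
  obtain ⟨l'', h'', e⟩ := H.lead_mul (a := a) (b := b) hl hl'
  rw [e]
  exact H.lead_ne_zero (hR _ _ ha ((map_ne_zero_iff _ (σ ^ m).injective).2 hb)) h''

theorem pseudo_div (H : IsOreExtension R S x σ δ) (hR : ∀ a b : R, a ≠ 0 → b ≠ 0 → a * b ≠ 0) (h1 : (1 : R) ≠ 0)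
    (hO : ∀ a b : R, b ≠ 0 → ∃ c e : R, c ≠ 0 ∧ c * a = e * b)
    {k : ℕ} {b : R} (hb : b ≠ 0) {l' : A} (hl' : l' ∈ degLT R x k) (n : ℕ) :
    ∀ f ∈ degLT R x n, ∃ c : R, c ≠ 0 ∧ ∃ h ∈ S,
      (c : A) * f - h * ((b : A) * x ^ k + l') ∈ degLT R x k := by
  induction n with
  | zero => exact fun f hf => ⟨1, h1, 0, S.zero_mem, by simp [degLT_zero hf]⟩
  | succ n ih =>
    intro f hf
    rcases Nat.lt_or_ge n k with hnk | hnk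
    · exact ⟨1, h1, 0, S.zero_mem, by simpa using degLT_mono (by omega) hf⟩
    obtain ⟨a, l, hl, rfl⟩ := degLT_succ hf
    obtain ⟨c, e, hc, hce⟩ := hO a ((σ ^ (n - k)) b)
      ((map_ne_zero_iff _ (σ ^ (n - k)).injective).2 hb)
    obtain ⟨p, hp, ep⟩ := H.lead_mul (a := e) (b := b) (l := 0) (m := n - k) (zero_mem _) hl'
    rw [add_zero, Nat.sub_add_cancel hnk, ← hce] at ep
    rw [Nat.sub_add_cancel hnk] at hp
    obtain ⟨c', hc', h, hh, hm⟩ := ih ((c : A) * l - p) (sub_mem (degLT_smul _ hl) hp)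
    refine ⟨c' * c, hR _ _ hc' hc, (c' : A) * ((e : A) * x ^ (n - k)) + h, ?_, ?_⟩
    · exact S.add_mem (S.mul_mem (H.le c'.2) (S.mul_mem (H.le e.2) (S.pow_mem H.mem _))) hh
    · convert hm using 1
      rw [add_mul, mul_assoc (c' : A), ep]
      push_cast
      noncomm_ring

theorem ore (H : IsOreExtension R S x σ δ) (hR : ∀ a b : R, a ≠ 0 → b ≠ 0 → a * b ≠ 0) (h1 : (1 : R) ≠ 0)
    (hO : ∀ a b : R, b ≠ 0 → ∃ c e : R, c ≠ 0 ∧ c * a = e * b) (k : ℕ) :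
    ∀ g ∈ degLT R x k, g ≠ 0 → ∀ f ∈ S, ∃ u ∈ S, ∃ v ∈ S, u ≠ 0 ∧ u * f = v * g := by
  induction k using Nat.strong_induction_on with
  | _ k ih =>
    intro g hg g0 f hf
    have hgS := H.degLT_le hg
    obtain ⟨j, hj, b, hb, l', hl', rfl⟩ := exists_lead hg g0
    obtain ⟨n, hn⟩ := H.exists_degLT hf
    obtain ⟨c, hc, h, hh, hr⟩ := H.pseudo_div hR h1 hO hb hl' n f hn
    have hc' : (c : A) ≠ 0 := by simpa using hc
    set g := (b : A) * x ^ j + l' with hgdef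
    by_cases r0 : (c : A) * f - h * g = 0
    · exact ⟨c, H.le c.2, h, hh, hc', sub_eq_zero.1 r0⟩
    obtain ⟨u, hu, v, hv, u0, e⟩ := ih j hj _ hr r0 g hgS
    have v0 : v ≠ 0 := by
      rintro rfl
      rw [zero_mul] at e
      exact H.mul_ne_zero hR hu hgS u0 g0 e
    refine ⟨v * c, S.mul_mem hv (H.le c.2), v * h + u, S.add_mem (S.mul_mem hv hh) hu,
      H.mul_ne_zero hR hv (H.le c.2) v0 hc', ?_⟩
    rw [add_mul, e]
    noncomm_ring

end IsOreExtension

end OreExtension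

section Tower

variable (K : Type*) [Field K] {A : Type*} [Ring A] [Algebra K A] {N : ℕ}

/-- `A_k = K⟨X_1, …, X_k⟩`, the subalgebra generated by the first `k` of the elements
`X_1, …, X_N`. The index set `{1, …, N}` is modelled by `Fin N`, so that `X i` is `X_{i+1}`. -/
def lowerSubalgebra (X : Fin N → A) (k : ℕ) : Subalgebra K A :=
  Algebra.adjoin K (X '' {i : Fin N | (i : ℕ) < k})

theorem mem_lowerSubalgebra (X : Fin N → A) {k : ℕ} {l : Fin N} (h : (l : ℕ) < k) :
    X l ∈ lowerSubalgebra K X k :=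
  Algebra.subset_adjoin ⟨l, h, rfl⟩

end Tower

/-- A presentation of the `K`-algebra `A` as an iterated Ore extension
`K[X_1][X_2; σ_2, δ_2] ⋯ [X_N; σ_N, δ_N]` that satisfies the axioms of a quantum nilpotent algebra.
The index set `{1, …, N}` is modelled by `Fin N`, so that `X i` is `X_{i+1}`, and `σ i`, `δ i` and
`d i n` are operators of the subalgebra `lowerSubalgebra K X i`, generated by the earlier variables.
For the first variable this subalgebra is `K`, where an automorphism is the identity and
a derivation is zero. -/
structure QuantumNilpotent (K : Type*) [Field K] (N : ℕ) (A : Type*) [Ring A] [Algebra K A] where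
  X : Fin N → A
  σ : ∀ i : Fin N, lowerSubalgebra K X i ≃ₐ[K] lowerSubalgebra K X i
  δ : ∀ i : Fin N, lowerSubalgebra K X i →ₗ[K] lowerSubalgebra K X i
  /-- The tower starts with `K` itself. -/
  algebraMap_injective : Function.Injective (algebraMap K A)
  ore : ∀ i : Fin N, IsOreExtension (lowerSubalgebra K X i) (lowerSubalgebra K X (i + 1)) (X i)
    (σ i) (δ i)
  /-- The tower ends with `A`. -/
  top : lowerSubalgebra K X N = ⊤
  lam : Matrix (Fin N) (Fin N) K
  lam_ne_zero : ∀ i l : Fin N, lam i l ≠ 0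
  lam_antisymm : ∀ i l : Fin N, lam i l = (lam l i)⁻¹
  σ_X : ∀ (i l : Fin N) (h : l < i), σ i ⟨X l, mem_lowerSubalgebra K X h⟩ =
    lam i l • ⟨X l, mem_lowerSubalgebra K X h⟩
  q : Fin N → K
  qSkew : ∀ i : Fin N, 0 < (i : ℕ) → IsQSkew (q i) (σ i) (δ i)
  d : ∀ i : Fin N, ℕ → lowerSubalgebra K X i →ₗ[K] lowerSubalgebra K X i
  higher : ∀ i : Fin N, 0 < (i : ℕ) → IsHigherSkewDerivation (q i) (σ i) (δ i) (d i)
  locallyNilpotent : ∀ i : Fin N, 0 < (i : ℕ) → IsLocallyNilpotentSeq (d i)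
  iterative : ∀ i : Fin N, 0 < (i : ℕ) → IsIterativeSeq (q i) (d i)
  /-- `σ_l ∘ d_{i,n} = λ_{l,i}^n d_{i,n} ∘ σ_l` on the domain of `d_{i,n}`, for `i < l`. -/
  σ_d : ∀ (i l : Fin N), 0 < (i : ℕ) → ∀ (h : i < l) (n : ℕ) (a b : lowerSubalgebra K X i),
    (b : A) = σ l ⟨a, Algebra.adjoin_mono (Set.image_mono fun _ hk => lt_trans hk h) a.2⟩ →
    (σ l ⟨d i n a, Algebra.adjoin_mono (Set.image_mono fun _ hk => lt_trans hk h) (d i n a).2⟩ : A)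
      = lam l i ^ n • (d i n b : A)

/-- `P` is a completely prime ideal: a proper two-sided ideal such that the quotient ring is
a domain. -/
def TwoSidedIdeal.IsCompletelyPrime {R : Type*} [Ring R] (P : TwoSidedIdeal R) : Prop :=
  P ≠ ⊤ ∧ ∀ a b : R, a * b ∈ P → a ∈ P ∨ b ∈ P

/-- The set `C.Spec(R)` of the completely prime ideals of `R`. -/
def CSpec (R : Type*) [Ring R] : Set (TwoSidedIdeal R) :=
  {P | P.IsCompletelyPrime}

namespace QuantumNilpotent

variable {K : Type*} [Field K] {N : ℕ} {A : Type*} [Ring A] [Algebra K A]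

theorem nontrivial (D : QuantumNilpotent K N A) : Nontrivial A :=
  D.algebraMap_injective.nontrivial

theorem lower_domain_ore (D : QuantumNilpotent K N A) (k : ℕ) (hk : k ≤ N) :
    (∀ a b : lowerSubalgebra K D.X k, a ≠ 0 → b ≠ 0 → a * b ≠ 0) ∧
    ∀ a b : lowerSubalgebra K D.X k, b ≠ 0 →
      ∃ c e : lowerSubalgebra K D.X k, c ≠ 0 ∧ c * a = e * b := by
  have := D.nontrivial
  induction k with
  | zero =>
    have hbot : lowerSubalgebra K D.X 0 = ⊥ := by simp [lowerSubalgebra]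
    have hz : ∀ a : lowerSubalgebra K D.X 0, ∃ r : K, a = algebraMap K _ r := by
      rintro ⟨a, ha⟩
      rw [hbot] at ha
      obtain ⟨r, rfl⟩ := Algebra.mem_bot.1 ha
      exact ⟨r, rfl⟩
    constructor
    · intro a b ha hb
      obtain ⟨r, rfl⟩ := hz a
      obtain ⟨s, rfl⟩ := hz b
      rw [← map_mul]
      refine (map_ne_zero _).2 (mul_ne_zero ?_ ?_)
      · rintro rfl; simp at ha
      · rintro rfl; simp at hb
    · intro a b hb
      obtain ⟨r, rfl⟩ := hz a
      obtain ⟨s, rfl⟩ := hz b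
      have hs : s ≠ 0 := by rintro rfl; simp at hb
      refine ⟨1, algebraMap K _ (r / s), one_ne_zero, ?_⟩
      rw [← map_mul, one_mul, div_mul_cancel₀ r hs]
  | succ k ih =>
    obtain ⟨hR, hO⟩ := ih (by omega)
    have H := D.ore ⟨k, hk⟩
    constructor
    · intro a b ha hb h
      exact H.mul_ne_zero hR a.2 b.2 (by simpa using ha) (by simpa using hb)
        (by simpa using congrArg Subtype.val h)
    · intro a b hb
      obtain ⟨n, hn⟩ := H.exists_degLT b.2
      obtain ⟨u, hu, v, hv, u0, e⟩ := H.ore hR one_ne_zero hO n b hn (by simpa using hb) a a.2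
      exact ⟨⟨u, hu⟩, ⟨v, hv⟩, fun h => u0 (congrArg Subtype.val h), Subtype.ext e⟩

theorem noZeroDivisors (D : QuantumNilpotent K N A) : NoZeroDivisors A where
  eq_zero_or_eq_zero_of_mul_eq_zero {a b} h := by
    have ht : ∀ a : A, a ∈ lowerSubalgebra K D.X N := fun a => by simp [D.top]
    by_contra hab
    push Not at hab
    refine (D.lower_domain_ore N le_rfl).1 ⟨a, ht a⟩ ⟨b, ht b⟩ ?_ ?_ (Subtype.ext h)
    · exact fun h => hab.1 (congrArg Subtype.val h)
    · exact fun h => hab.2 (congrArg Subtype.val h)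

theorem nonempty_oreSet (D : QuantumNilpotent K N A) : Nonempty (OreLocalization.OreSet A⁰) := by
  have := D.nontrivial
  have := D.noZeroDivisors
  have ht : ∀ a : A, a ∈ lowerSubalgebra K D.X N := fun a => by simp [D.top]
  refine OreLocalization.nonempty_oreSet_iff_of_noZeroDivisors.2 fun r s => ?_
  obtain ⟨c, e, hc, h⟩ := (D.lower_domain_ore N le_rfl).2 ⟨r, ht r⟩ ⟨s, ht s⟩
    (fun h => nonZeroDivisors.coe_ne_zero s (congrArg Subtype.val h))
  exact ⟨e, ⟨c, mem_nonZeroDivisors_of_ne_zero (by simpa using hc)⟩, congrArg Subtype.val h⟩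

variable (D : QuantumNilpotent K N A)

/-- The nonzero elements of `A` form an Ore set. -/
@[reducible] noncomputable def oreSet : OreLocalization.OreSet A⁰ :=
  D.nonempty_oreSet.some

/-- The division ring of fractions `Frac(A)`: the Ore localization of `A` at its nonzero elements. -/
def Frac : Type _ :=
  @OreLocalization A _ A⁰ D.oreSet A _

noncomputable instance : DivisionRing D.Frac :=
  @OreLocalization.instDivisionRingNonZeroDivisors A _ D.nontrivial D.noZeroDivisors D.oreSet

noncomputable instance : Algebra K D.Frac :=
  @OreLocalization.instAlgebra A _ A⁰ D.oreSet K _ _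

/-- The canonical embedding of `A` into `Frac(A)`. -/
noncomputable def toFrac : A →ₐ[K] D.Frac :=
  { (@OreLocalization.numeratorRingHom A _ A⁰ D.oreSet : A →+* D.Frac) with
    commutes' := fun _ => rfl }

theorem toFrac_injective : Function.Injective D.toFrac := by
  have := D.nontrivial
  have := D.noZeroDivisors
  let _ := D.oreSet
  have h : Function.Injective (OreLocalization.numeratorHom : A →* OreLocalization A⁰ A) :=
    OreLocalization.numeratorHom_inj inf_le_left
  exact h

/-- Each element of `Frac(A)` is a fraction of elements of `A`. -/
theorem exists_fraction (z : D.Frac) :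
    ∃ a s : A, s ≠ 0 ∧ z = (D.toFrac s)⁻¹ * D.toFrac a := by
  have := D.nontrivial
  obtain ⟨r, s, h⟩ : ∃ (r : A) (s : A⁰), D.toFrac s * z = D.toFrac r := by
    let _ := D.oreSet
    have key : ∀ z : OreLocalization A⁰ A, ∃ (r : A) (s : A⁰),
        (OreLocalization.numeratorRingHom (s : A) : OreLocalization A⁰ A) * z =
          OreLocalization.numeratorRingHom r := by
      intro z
      induction z using OreLocalization.ind with
      | _ r s => exact ⟨r, s, OreLocalization.mul_cancel⟩
    exact key z
  refine ⟨r, s, nonZeroDivisors.coe_ne_zero s, (eq_inv_mul_iff_mul_eq₀ ?_).2 h⟩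
  exact (map_ne_zero_iff _ D.toFrac_injective).2 (nonZeroDivisors.coe_ne_zero s)

/-! ### The deleting derivations algorithm -/

/-- The variable treated in step `k + 1` of the algorithm. The steps treat the variables
`X_N, X_{N-1}, …, X_2` in this order, so this is `X_j` with `j = N - k`, that is, the element
`N - 1 - k` of `Fin N`. -/
def stepIndex (k : ℕ) (h : k + 1 < N) : Fin N :=
  ⟨N - 1 - k, by omega⟩

/-- For `x_1, …, x_N` in `Frac(A)`, the image of `a ∈ K⟨X_1, …, X_{j-1}⟩` under the (unique) algebra
homomorphism that sends `X_i` to `x_i` for each `i < j`. The value `0` where there is no such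
homomorphism is a convention that plays no role. -/
noncomputable def transport (x : Fin N → D.Frac) (j : Fin N) (a : lowerSubalgebra K D.X j) :
    D.Frac :=
  open Classical in
  if h : ∃ φ : lowerSubalgebra K D.X j →ₐ[K] D.Frac,
      ∀ (i : Fin N) (hi : i < j), φ ⟨D.X i, mem_lowerSubalgebra K D.X hi⟩ = x i
  then h.choose a else 0

/-- The change of variables that deletes the derivation `δ_j`: for `l < j`,
`y_l = ∑_n q_j^{n(n+1)/2} (q_j - 1)^{-n} d_{j,n}(σ_j^{-n}(x_l)) x_j^{-n}`, and `y_l = x_l` for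
`l ≥ j`. Here `σ_j` and `d_{j,n}` act on the subalgebra generated by `x_1, …, x_{j-1}` through its
identification with `K⟨X_1, …, X_{j-1}⟩`. The sum is finite as `d_{j,n}` is locally nilpotent. -/
noncomputable def deleteStep (j : Fin N) (x : Fin N → D.Frac) (l : Fin N) : D.Frac :=
  if h : l < j then
    ∑ᶠ n : ℕ, (D.q j ^ (n * (n + 1) / 2) * ((D.q j - 1) ^ n)⁻¹) •
      (D.transport x j (D.d j n (((D.σ j).symm ^ n) ⟨D.X l, mem_lowerSubalgebra K D.X h⟩)) *
        (x j ^ n)⁻¹)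
  else x l

/-- The elements `X_1^{(N+1-k)}, …, X_N^{(N+1-k)}` of `Frac(A)` obtained after `k` steps. -/
noncomputable def gens : ℕ → Fin N → D.Frac
  | 0 => fun i => D.toFrac (D.X i)
  | k + 1 => if h : k + 1 < N then D.deleteStep (stepIndex k h) (gens k) else gens k

/-- The algebra `A^{(N+1-k)} = K⟨X_1^{(N+1-k)}, …, X_N^{(N+1-k)}⟩` obtained after `k` steps. -/
noncomputable def stage (k : ℕ) : Subalgebra K D.Frac :=
  Algebra.adjoin K (Set.range (D.gens k))

/-- The generators of `A^{(N+1-k)}`, as elements of that algebra. -/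
noncomputable def stageGen (k : ℕ) (i : Fin N) : D.stage k :=
  ⟨D.gens k i, Algebra.subset_adjoin ⟨i, rfl⟩⟩

theorem toFrac_mem_stage_zero (a : A) : D.toFrac a ∈ D.stage 0 := by
  have h : a ∈ lowerSubalgebra K D.X N := by simp [D.top]
  have e : D.stage 0 = (Algebra.adjoin K (Set.range D.X)).map D.toFrac := by
    rw [AlgHom.map_adjoin, ← Set.range_comp]
    rfl
  rw [e]
  exact ⟨a, Algebra.adjoin_mono (Set.image_subset_range _ _) h, rfl⟩

/-- The identification of `A` with `A^{(N+1)}`. -/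
noncomputable def toStageZero : A →ₐ[K] D.stage 0 :=
  D.toFrac.codRestrict (D.stage 0) D.toFrac_mem_stage_zero

/-- The algebra `A' = A^{(2)}`. -/
noncomputable abbrev A' : Subalgebra K D.Frac :=
  D.stage (N - 1)

/-- The generators `T_1, …, T_N` of `A'`. -/
noncomputable def T (i : Fin N) : D.A' :=
  D.stageGen (N - 1) i

/-! ### The canonical embedding -/

/-- The quotient `A^{(j+1)} / ⟨x_j⟩`, where `A^{(j+1)}` is the algebra obtained after `k` steps and
`x_j` is the generator treated in the next step. -/
abbrev StageQuotient (k : ℕ) (h : k + 1 < N) : Type _ :=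
  (TwoSidedIdeal.span {D.stageGen k (stepIndex k h)}).ringCon.Quotient

/-- The canonical projection of `A^{(j+1)}` onto `A^{(j+1)} / ⟨x_j⟩`. -/
noncomputable def stageMk (k : ℕ) (h : k + 1 < N) : D.stage k →+* D.StageQuotient k h :=
  (TwoSidedIdeal.span {D.stageGen k (stepIndex k h)}).ringCon.mk'

/-- The underlying set of `ψ_j(P)`, for an ideal `P` of `A^{(j+1)}`. If `x_j ∉ P`, it is
`P S_j⁻¹ ∩ A^{(j)}` with `S_j = {x_j^n}`. If `x_j ∈ P`, it is `g_j⁻¹(P / ⟨x_j⟩)`, where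
`g_j : A^{(j)} → A^{(j+1)} / ⟨x_j⟩` is the (unique) algebra homomorphism that sends each generator
`y_i` to the class of `x_i`. -/
def psiStepSet (k : ℕ) (h : k + 1 < N) (P : TwoSidedIdeal (D.stage k)) : Set (D.stage (k + 1)) :=
  {a | (D.stageGen k (stepIndex k h) ∉ P ∧
          ∃ p ∈ P, ∃ n : ℕ, (a : D.Frac) = (p : D.Frac) * (D.gens k (stepIndex k h) ^ n)⁻¹) ∨
       (D.stageGen k (stepIndex k h) ∈ P ∧
          ∃ g : D.stage (k + 1) →ₐ[K] D.StageQuotient k h,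
            (∀ i : Fin N, g (D.stageGen (k + 1) i) = D.stageMk k h (D.stageGen k i)) ∧
            ∃ p ∈ P, g a = D.stageMk k h p)}

/-- The map `ψ_j` from ideals of `A^{(j+1)}` to ideals of `A^{(j)}`. Where the set above is not an
ideal, the value is the unit ideal, which is not completely prime. -/
noncomputable def psiStep (k : ℕ) (h : k + 1 < N) (P : TwoSidedIdeal (D.stage k)) :
    TwoSidedIdeal (D.stage (k + 1)) :=
  open Classical in
  if hQ : ∃ Q : TwoSidedIdeal (D.stage (k + 1)), (Q : Set (D.stage (k + 1))) = D.psiStepSet k h P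
  then hQ.choose else ⊤

/-- The composite `ψ_j ∘ ⋯ ∘ ψ_N` of the first `k` of these maps, where `j = N + 1 - k`. -/
noncomputable def psiAux (P : TwoSidedIdeal A) : ∀ k : ℕ, k ≤ N - 1 → TwoSidedIdeal (D.stage k)
  | 0, _ => P.map D.toStageZero
  | k + 1, h => D.psiStep k (by omega) (psiAux P k (by omega))

/-- The canonical embedding `ψ = ψ_2 ∘ ⋯ ∘ ψ_N`. -/
noncomputable def psi (P : TwoSidedIdeal A) : TwoSidedIdeal D.A' :=
  D.psiAux P (N - 1) le_rfl

/-! ### The strata -/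

/-- `C.Spec_w(A') = {Q ∈ C.Spec(A') | Q ∩ {T_1, …, T_N} = {T_i | i ∈ w}}`. -/
def stratum' (w : Finset (Fin N)) : Set (TwoSidedIdeal D.A') :=
  {Q | Q ∈ CSpec D.A' ∧ (Q : Set D.A') ∩ Set.range D.T = D.T '' (w : Set (Fin N))}

/-- `C.Spec_w(A) = ψ⁻¹(C.Spec_w(A'))`. -/
def stratum (w : Finset (Fin N)) : Set (TwoSidedIdeal A) :=
  {P | P ∈ CSpec A ∧ D.psi P ∈ D.stratum' w}

/-- The set `W'` of Cauchon diagrams: the subsets `w` of the index set such that `C.Spec_w(A)` is not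
empty. -/
def cauchonDiagrams : Set (Finset (Fin N)) :=
  {w | (D.stratum w).Nonempty}

end QuantumNilpotent

/-! Everything rests on one claim: each step `psiStep` sends completely prime ideals to completely
prime ideals. Once this is known, `P` lies in the stratum of `w = {i | T_i ∈ ψ(P)}`, and in no other
because the `T_i` are distinct. No injectivity of `ψ` is needed.

To control one step, write `Δ` for the map `a ↦ ∑ c_n d_n(σ^{-n}(a)) x^{-n}`, with `x = x_j` and
`c_n` the deletion coefficients. The `q`-Leibniz rule, the iterativity of `d` and two identities for
`c_n` make `Δ` an algebra homomorphism with `x Δ(a) = Δ(σ(a)) x` (`deletionFun_mul`,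
`mul_deletionFun`). As `Δ(a)` is `φ(a)` plus terms in negative powers of `x`, comparing leading
coefficients shows that `Δ` is injective and that the powers of `x` stay left independent over its
image (`deletionFun_sum_lead`). Hence the invariant `IsDeleted` passes from one stage to the next.

If `x ∉ P`, local nilpotency gives the right Ore condition for the powers of `x`. The new algebra
consists of fractions `s x^{-n}` over the old one, and complete primeness survives localization
followed by intersection (`exists_completelyPrime_of_rightFractions`). If `x ∈ P`, the work is in
the existence of `g_j`. It is `Δ(a) ↦ φ(a)` modulo `x` on the earlier variables, and extends to the
later ones because these satisfy only quasi-commutation relations over the earlier ones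
(`graph_functional`, `exists_stageQuotient_hom`). The preimage of a completely prime ideal is then
completely prime. -/

section DeletionMap

/-! ### The deletion map is an algebra homomorphism. -/

open Finset

variable {K : Type*} [Field K] {R : Type*} [Ring R] [Algebra K R]

namespace IsHigherSkewDerivation

variable {q : K} {σ : R ≃ₐ[K] R} {δ : R →ₗ[K] R} {d : ℕ → R →ₗ[K] R}

theorem apply_pow (H : IsHigherSkewDerivation q σ δ d) (n m : ℕ) (r : R) :
    d n ((σ ^ m) r) = q ^ (n * m) • (σ ^ m) (d n r) := by
  induction m with
  | zero => simp
  | succ m ih =>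
    rw [pow_succ', AlgEquiv.mul_apply, H.skew, ih, map_smul, smul_smul, AlgEquiv.mul_apply,
      ← pow_add, Nat.mul_succ, Nat.add_comm]

theorem pow_apply (H : IsHigherSkewDerivation q σ δ d) (hq : q ≠ 0) (n m : ℕ) (r : R) :
    (σ ^ m) (d n r) = (q ^ (n * m))⁻¹ • d n ((σ ^ m) r) := by
  rw [H.apply_pow, smul_smul, inv_mul_cancel₀ (pow_ne_zero _ hq), one_smul]

/-- Since `d n` and `σ` commute up to a nonzero scalar, the kernel of `d n` is stable under `σ⁻¹`. A
nilpotency bound for `a` therefore truncates the whole series `∑ c_n d_n(σ^{-n}(a)) x^{-n}`. -/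
theorem eq_zero_of_symm_pow (H : IsHigherSkewDerivation q σ δ d) (hq : q ≠ 0) (n m : ℕ) (r : R)
    (h : d n r = 0) : d n ((σ.symm ^ m) r) = 0 := by
  have e : (σ ^ m) ((σ.symm ^ m) r) = r := by
    rw [← AlgEquiv.mul_apply, show σ.symm = σ⁻¹ from rfl, inv_pow, mul_inv_cancel]
    rfl
  have h1 := H.pow_apply hq n m ((σ.symm ^ m) r)
  rw [e, h, smul_zero] at h1
  exact (map_eq_zero_iff _ (σ ^ m).injective).1 h1

end IsHigherSkewDerivation

/-- The coefficient `q^{n(n+1)/2} (q - 1)^{-n}` of the deleting derivations formula. -/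
def deletionCoeff (q : K) (n : ℕ) : K :=
  q ^ (n * (n + 1) / 2) * ((q - 1) ^ n)⁻¹

theorem triangle_add (i m : ℕ) :
    (i + m) * (i + m + 1) / 2 = i * (i + 1) / 2 + m * (m + 1) / 2 + i * m := by
  have h1 := Nat.even_mul_succ_self i
  have h2 := Nat.even_mul_succ_self m
  obtain ⟨a, ha⟩ := h1
  obtain ⟨b, hb⟩ := h2
  have : (i + m) * (i + m + 1) = 2 * (a + b + i * m) := by nlinarith
  rw [this, ha, hb]
  omega

/-- The cross term `q ^ (i * m)` is exactly the cost of moving `σ ^ m` past `d i`; this makes the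
deletion map multiplicative. -/
theorem deletionCoeff_add (q : K) (i m : ℕ) :
    deletionCoeff q (i + m) = deletionCoeff q i * deletionCoeff q m * q ^ (i * m) := by
  simp only [deletionCoeff, triangle_add, pow_add, mul_inv]
  ring

theorem qBinom_self (q : K) (n : ℕ) : qBinom q n n = 1 := by
  induction n with
  | zero => rfl
  | succ n ih => simp [qBinom, ih, qBinom_eq_zero]

theorem qBinom_succ_self (q : K) (n : ℕ) :
    qBinom q (n + 1) n = ∑ i ∈ range (n + 1), q ^ i := by
  induction n with
  | zero => simp [qBinom]
  | succ n ih => rw [qBinom, ih, qBinom_self, sum_range_succ, sum_range_succ, mul_one,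
      sum_range_succ]

/-- By `deletionCoeff_add`, `c_{n+1} = c_n q^{n+1} / (q - 1)`, while the binomial is `(q^{n+1} - 1)
/ (q - 1)`. Only `q ≠ 0, 1` is used, so roots of unity are allowed. This is the coefficient
comparison in `mul_deletionFun`. -/
theorem deletionCoeff_succ {q : K} (hq : q ≠ 0) (hq1 : q ≠ 1) (n : ℕ) :
    deletionCoeff q (n + 1) * (q ^ (n + 1))⁻¹ + deletionCoeff q n * qBinom q (n + 1) n =
      deletionCoeff q (n + 1) := by
  have h1 : q - 1 ≠ 0 := sub_ne_zero.2 hq1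
  have hg : ∑ i ∈ range (n + 1), q ^ i = (q ^ (n + 1) - 1) / (q - 1) := geom_sum_eq hq1 (n + 1)
  have hc : deletionCoeff q 1 = q * (q - 1)⁻¹ := by simp [deletionCoeff]
  rw [deletionCoeff_add, hc, qBinom_succ_self, mul_one, hg]
  field_simp
  ring

variable {F : Type*} [DivisionRing F] [Algebra K F]

/-- The map `a ↦ ∑_n q^{n(n+1)/2} (q - 1)^{-n} d_n(σ^{-n}(a)) x^{-n}`. -/
noncomputable def deletionFun (q : K) (σ : R ≃ₐ[K] R) (d : ℕ → R →ₗ[K] R) (φ : R →ₐ[K] F) (x : F)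
    (a : R) : F :=
  ∑ᶠ n : ℕ, deletionCoeff q n • (φ (d n ((σ.symm ^ n) a)) * (x ^ n)⁻¹)

variable {q : K} {σ : R ≃ₐ[K] R} {δ : R →ₗ[K] R} {d : ℕ → R →ₗ[K] R} {φ : R →ₐ[K] F} {x : F}

theorem deletionFun_eq_sum (H : IsHigherSkewDerivation q σ δ d) (hq : q ≠ 0) {a : R} {m : ℕ}
    (h : ∀ n, m ≤ n → d n a = 0) :
    deletionFun q σ d φ x a =
      ∑ n ∈ range m, deletionCoeff q n • (φ (d n ((σ.symm ^ n) a)) * (x ^ n)⁻¹) := by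
  refine finsum_eq_sum_of_support_subset _ fun n hn => ?_
  rw [mem_coe, mem_range]
  by_contra hmn
  refine hn (?_ : _ • _ = _)
  rw [H.eq_zero_of_symm_pow hq n n a (h n (by omega)), map_zero, zero_mul, smul_zero]

theorem deletionFun_add (H : IsHigherSkewDerivation q σ δ d) (hq : q ≠ 0)
    (hd : IsLocallyNilpotentSeq d) (a b : R) :
    deletionFun q σ d φ x (a + b) = deletionFun q σ d φ x a + deletionFun q σ d φ x b := by
  obtain ⟨m, hm⟩ := hd a
  obtain ⟨k, hk⟩ := hd b
  have ha : ∀ n, max m k ≤ n → d n a = 0 := fun n hn => hm n (le_trans (le_max_left _ _) hn)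
  have hb : ∀ n, max m k ≤ n → d n b = 0 := fun n hn => hk n (le_trans (le_max_right _ _) hn)
  rw [deletionFun_eq_sum H hq ha, deletionFun_eq_sum H hq hb,
    deletionFun_eq_sum H hq fun n hn => by rw [map_add, ha n hn, hb n hn, add_zero],
    ← sum_add_distrib]
  simp only [map_add, add_mul, smul_add]

theorem deletionFun_smul (c : K) (a : R) :
    deletionFun q σ d φ x (c • a) = c • deletionFun q σ d φ x a := by
  rw [deletionFun, deletionFun, smul_finsum]
  simp only [map_smul, smul_mul_assoc, smul_comm c]

/-- Moving `x` to the right through `φ(d_n(b))` leaves a `σ` term and a `δ` term. By iterativity `δ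
d_n` is a multiple of `d_{n+1}`, so the `δ` term of index `n` meets the `σ` term of index `n + 1`,
and `deletionCoeff_succ` adds them up. -/
theorem mul_deletionFun (H : IsHigherSkewDerivation q σ δ d) (hq : q ≠ 0) (hq1 : q ≠ 1)
    (hd : IsLocallyNilpotentSeq d) (hit : IsIterativeSeq q d) (hx : x ≠ 0)
    (hc : ∀ r, x * φ r = φ (σ r) * x + φ (δ r)) (a : R) :
    x * deletionFun q σ d φ x a = deletionFun q σ d φ x (σ a) * x := by
  obtain ⟨m, hm⟩ := hd a
  have h1 : ∀ n, m ≤ n → d n (σ a) = 0 := fun n hn => by rw [H.skew, hm n hn, map_zero, smul_zero]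
  have e (n : ℕ) : (σ.symm ^ (n + 1)) (σ a) = (σ.symm ^ n) a := by
    rw [pow_succ, AlgEquiv.mul_apply, AlgEquiv.symm_apply_apply]
  have e' (n : ℕ) : σ ((σ.symm ^ (n + 1)) a) = (σ.symm ^ n) a := by
    rw [pow_succ', AlgEquiv.mul_apply, AlgEquiv.apply_symm_apply]
  -- The cuts `m + 1` and `m + 2` are chosen so that, after the terms of index `0` are split off and
  -- vanishing last terms dropped, all remaining sums run over `range m`.
  rw [deletionFun_eq_sum H hq (m := m + 1) fun n hn => hm n (by omega),
    deletionFun_eq_sum H hq (m := m + 2) fun n hn => h1 n (by omega), mul_sum, sum_mul]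
  have hs (n : ℕ) (b : R) : σ (d n b) = (q ^ n)⁻¹ • d n (σ b) := by
    rw [H.skew, smul_smul, inv_mul_cancel₀ (pow_ne_zero _ hq), one_smul]
  have hL (n : ℕ) : x * deletionCoeff q n • (φ (d n ((σ.symm ^ n) a)) * (x ^ n)⁻¹) =
      (deletionCoeff q n * (q ^ n)⁻¹) • (φ (d n (σ ((σ.symm ^ n) a))) * (x * (x ^ n)⁻¹)) +
      (deletionCoeff q n * qBinom q (n + 1) n) • (φ (d (n + 1) ((σ.symm ^ n) a)) * (x ^ n)⁻¹) := by
    have h2 : δ (d n ((σ.symm ^ n) a)) =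
        qBinom q (n + 1) n • d (n + 1) ((σ.symm ^ n) a) := by
      rw [← H.one, hit 1 n, Nat.add_comm]
    rw [mul_smul_comm, ← mul_assoc, hc, h2, hs, map_smul, map_smul, add_mul, smul_add,
      smul_mul_assoc, smul_mul_assoc, smul_mul_assoc, smul_smul, smul_smul, mul_assoc]
  have hR (n : ℕ) : (deletionCoeff q (n + 1) •
      (φ (d (n + 1) ((σ.symm ^ (n + 1)) (σ a))) * (x ^ (n + 1))⁻¹)) * x =
      deletionCoeff q (n + 1) • (φ (d (n + 1) ((σ.symm ^ n) a)) * (x ^ n)⁻¹) := by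
    rw [e, smul_mul_assoc, mul_assoc, pow_succ', mul_inv_rev, inv_mul_cancel_right₀ hx]
  have hxx (n : ℕ) : x * (x ^ (n + 1))⁻¹ = (x ^ n)⁻¹ := by
    rw [pow_succ, mul_inv_rev, mul_inv_cancel_left₀ hx]
  simp only [hL]
  rw [sum_add_distrib, sum_range_succ', sum_range_succ' _ (m + 1)]
  simp only [hR, e', hxx]
  have hz : d (m + 1) ((σ.symm ^ m) a) = 0 := H.eq_zero_of_symm_pow hq _ _ _ (hm _ (by omega))
  have hz' : d (m + 1) ((σ.symm ^ (m + 1)) (σ a)) = 0 :=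
    H.eq_zero_of_symm_pow hq _ _ _ (h1 _ (by omega))
  rw [sum_range_succ _ m, sum_range_succ _ m, hz]
  simp only [map_zero, zero_mul, smul_zero, add_zero]
  rw [add_right_comm, ← sum_add_distrib]
  congr 1
  · refine sum_congr rfl fun n _ => ?_
    rw [← add_smul, deletionCoeff_succ hq hq1]
  · simp [deletionCoeff, H.zero]

theorem inv_pow_mul_deletionFun (H : IsHigherSkewDerivation q σ δ d) (hq : q ≠ 0) (hq1 : q ≠ 1)
    (hd : IsLocallyNilpotentSeq d) (hit : IsIterativeSeq q d) (hx : x ≠ 0)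
    (hc : ∀ r, x * φ r = φ (σ r) * x + φ (δ r)) (n : ℕ) (a : R) :
    (x ^ n)⁻¹ * deletionFun q σ d φ x a = deletionFun q σ d φ x ((σ.symm ^ n) a) * (x ^ n)⁻¹ := by
  induction n generalizing a with
  | zero => simp
  | succ n ih =>
    have h := mul_deletionFun H hq hq1 hd hit hx hc (σ.symm a)
    rw [AlgEquiv.apply_symm_apply] at h
    have h' : x⁻¹ * deletionFun q σ d φ x a = deletionFun q σ d φ x (σ.symm a) * x⁻¹ := by
      rw [inv_mul_eq_iff_eq_mul₀ hx, ← mul_assoc, h, mul_inv_cancel_right₀ hx]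
    rw [pow_succ', mul_inv_rev, mul_assoc, h', ← mul_assoc, ih, pow_succ, AlgEquiv.mul_apply,
      mul_assoc]

theorem sum_range_antidiagonal {M : Type*} [AddCommMonoid M] (f : ℕ → ℕ → M) (m k : ℕ)
    (hf : ∀ i l, m ≤ i ∨ k ≤ l → f i l = 0) :
    ∑ n ∈ range (m + k), ∑ i ∈ range (n + 1), f i (n - i) =
      ∑ i ∈ range m, ∑ l ∈ range k, f i l := by
  rw [← sum_product', ← sum_fiberwise_of_maps_to (t := range (m + k)) (g := fun p : ℕ × ℕ => p.1 + p.2)]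
  · refine sum_congr rfl fun n hn => ?_
    rw [← Nat.sum_antidiagonal_eq_sum_range_succ f]
    symm
    refine sum_subset ?_ ?_
    · intro p hp
      simp only [mem_filter] at hp
      simpa using hp.2
    · intro p hp hp'
      refine hf _ _ ?_
      simp only [mem_filter, mem_product, mem_range, HasAntidiagonal.mem_antidiagonal] at hp hp'
      omega
  · intro p hp
    simp only [mem_product, mem_range] at hp ⊢
    omega

/-- In the product of the two series, `x^{-i}` passes the second factor and turns `b` into
`σ^{-i}(b)`. In the series of `a * b`, the Leibniz rule produces `σ^l d_i`, and rewriting it as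
`q^{-il} d_i σ^l` cancels the cross term of `deletionCoeff_add`. The two sums then agree along
antidiagonals. -/
theorem deletionFun_mul (H : IsHigherSkewDerivation q σ δ d) (hq : q ≠ 0) (hq1 : q ≠ 1)
    (hd : IsLocallyNilpotentSeq d) (hit : IsIterativeSeq q d) (hx : x ≠ 0)
    (hc : ∀ r, x * φ r = φ (σ r) * x + φ (δ r)) (a b : R) :
    deletionFun q σ d φ x (a * b) = deletionFun q σ d φ x a * deletionFun q σ d φ x b := by
  obtain ⟨m, hm⟩ := hd a
  obtain ⟨k, hk⟩ := hd b
  have hab : ∀ n, m + k ≤ n → d n (a * b) = 0 := by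
    intro n hn
    rw [H.mul]
    refine sum_eq_zero fun i hi => ?_
    rw [mem_range] at hi
    rcases Nat.lt_or_ge i m with h | h
    · rw [hk (n - i) (by omega), mul_zero]
    · rw [hm i h, map_zero, zero_mul]
  let f (i l : ℕ) : F := (deletionCoeff q i * deletionCoeff q l) •
    (φ (d i ((σ.symm ^ i) a)) * φ (d l ((σ.symm ^ l) ((σ.symm ^ i) b))) * (x ^ (i + l))⁻¹)
  have h1 : deletionFun q σ d φ x a * deletionFun q σ d φ x b =
      ∑ i ∈ range m, ∑ l ∈ range k, f i l := by
    rw [deletionFun_eq_sum H hq hm, sum_mul]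
    refine sum_congr rfl fun i _ => ?_
    rw [smul_mul_assoc, mul_assoc, inv_pow_mul_deletionFun H hq hq1 hd hit hx hc,
      deletionFun_eq_sum H hq (m := k)
        fun n hn => H.eq_zero_of_symm_pow hq _ _ _ (hk n hn), sum_mul, mul_sum, smul_sum]
    refine sum_congr rfl fun l _ => ?_
    simp only [f]
    rw [smul_mul_assoc, mul_smul_comm, smul_smul, pow_add, mul_inv_rev]
    simp only [mul_assoc]
  rw [h1, deletionFun_eq_sum H hq hab, ← sum_range_antidiagonal f m k]
  · refine sum_congr rfl fun n _ => ?_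
    rw [map_mul, H.mul, map_sum, sum_mul, smul_sum]
    refine sum_congr rfl fun i hi => ?_
    rw [mem_range] at hi
    obtain ⟨l, rfl⟩ := Nat.exists_eq_add_of_le (Nat.lt_succ_iff.1 hi)
    simp only [f, Nat.add_sub_cancel_left]
    have e : (σ ^ l) ((σ.symm ^ (i + l)) a) = (σ.symm ^ i) a := by
      rw [Nat.add_comm, pow_add, AlgEquiv.mul_apply, ← AlgEquiv.mul_apply (σ ^ l),
        show σ.symm = σ⁻¹ from rfl, inv_pow, mul_inv_cancel, AlgEquiv.one_apply]
    rw [H.pow_apply hq, e, map_mul, map_smul, smul_mul_assoc, smul_mul_assoc, smul_smul,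
      deletionCoeff_add, mul_inv_cancel_right₀ (pow_ne_zero _ hq), ← AlgEquiv.mul_apply (σ.symm ^ l),
      ← pow_add, Nat.add_comm l i]
  · rintro i l (h | h)
    · simp only [f]
      rw [H.eq_zero_of_symm_pow hq i i a (hm i h), map_zero, zero_mul, zero_mul, smul_zero]
    · simp only [f]
      rw [H.eq_zero_of_symm_pow hq l l _ (H.eq_zero_of_symm_pow hq l i b (hk l h)), map_zero,
        mul_zero, zero_mul, smul_zero]

theorem IsHigherSkewDerivation.apply_one (H : IsHigherSkewDerivation q σ δ d) (n : ℕ) :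
    d (n + 1) (1 : R) = 0 := by
  induction n using Nat.strong_induction_on with
  | _ n ih =>
    have h := H.mul (n + 1) 1 1
    have hz : ∑ i ∈ range n, (σ ^ (n + 1 - (i + 1))) (d (i + 1) 1) * d (n + 1 - (i + 1)) 1 =
        (0 : R) := by
      refine sum_eq_zero fun i hi => ?_
      rw [ih i (mem_range.1 hi), map_zero, zero_mul]
    -- Only the two extreme terms of the Leibniz sum survive, leaving `d (n + 1) 1 = d (n + 1) 1 + d
    -- (n + 1) 1`.
    rw [sum_range_succ, sum_range_succ', hz, mul_one, H.zero, Nat.sub_self, H.zero] at h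
    simpa using h

theorem deletionFun_one (H : IsHigherSkewDerivation q σ δ d) (hq : q ≠ 0) :
    deletionFun q σ d φ x 1 = 1 := by
  rw [deletionFun_eq_sum H hq (m := 1) fun n hn => ?_]
  · simp [deletionCoeff, H.zero]
  · obtain ⟨n, rfl⟩ := Nat.exists_eq_add_of_le' hn
    exact H.apply_one n

/-- Clearing the denominator gives a left polynomial in `x` over the image of `φ`, whose coefficient
at `x ^ m` is `φ a`. -/
theorem deletionFun_mul_pow (H : IsHigherSkewDerivation q σ δ d) (hq : q ≠ 0) (hx : x ≠ 0) {a : R}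
    {m : ℕ} (h : ∀ n, m < n → d n a = 0) :
    deletionFun q σ d φ x a * x ^ m =
      ∑ n ∈ range (m + 1), φ (deletionCoeff q n • d n ((σ.symm ^ n) a)) * x ^ (m - n) := by
  rw [deletionFun_eq_sum H hq (m := m + 1) fun n hn => h n (by omega), sum_mul]
  refine sum_congr rfl fun n hn => ?_
  rw [mem_range] at hn
  rw [map_smul, smul_mul_assoc, smul_mul_assoc, mul_assoc]
  congr 2
  rw [inv_mul_eq_iff_eq_mul₀ (pow_ne_zero _ hx), ← pow_add]
  congr 1
  omega

/-- The deleting derivations map is a homomorphism of algebras. -/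
noncomputable def deletionHom (H : IsHigherSkewDerivation q σ δ d) (hq : q ≠ 0) (hq1 : q ≠ 1)
    (hd : IsLocallyNilpotentSeq d) (hit : IsIterativeSeq q d) (hx : x ≠ 0)
    (hc : ∀ r, x * φ r = φ (σ r) * x + φ (δ r)) : R →ₐ[K] F :=
  AlgHom.ofLinearMap
    { toFun := deletionFun q σ d φ x
      map_add' := deletionFun_add H hq hd
      map_smul' := deletionFun_smul }
    (deletionFun_one H hq) (deletionFun_mul H hq hq1 hd hit hx hc)

end DeletionMap

/-! ### Left independence of the powers of an element. -/

section SkewFree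

open Finset Polynomial

variable {K : Type*} [Field K] {F : Type*} [Ring F] [Algebra K F]

/-- The powers of `x` are left linearly independent over the subalgebra `L`. -/
def IsSkewFree (L : Subalgebra K F) (x : F) : Prop :=
  ∀ p : F[X], (∀ n, p.coeff n ∈ L) → p.eval x = 0 → p = 0

theorem IsSkewFree.sum_eq_zero {L : Subalgebra K F} {x : F} (h : IsSkewFree L x) {N : ℕ}
    {c : ℕ → F} (hc : ∀ n < N, c n ∈ L) (h0 : ∑ n ∈ range N, c n * x ^ n = 0) {n : ℕ} (hn : n < N) :
    c n = 0 := by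
  have hco (k : ℕ) : (∑ n ∈ range N, monomial n (c n)).coeff k = if k < N then c k else 0 := by
    simp [coeff_monomial]
  have h1 := h (∑ n ∈ range N, monomial n (c n)) (fun k => ?_) ?_
  · simpa [hco, hn] using congrArg (fun p => coeff p n) h1
  · rw [hco]
    split_ifs with hk
    · exact hc k hk
    · exact L.zero_mem
  · rw [eval_finsetSum]
    simpa [eval_monomial] using h0

theorem IsSkewFree.not_mem {L : Subalgebra K F} {x : F} [Nontrivial F] (h : IsSkewFree L x) :
    x ∉ L := by
  intro hx
  have h1 := h (X - C x) (fun n => ?_) (by simp)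
  · exact X_sub_C_ne_zero x h1
  · rw [coeff_sub, coeff_X, coeff_C]
    refine L.sub_mem ?_ ?_
    · split_ifs
      exacts [L.one_mem, L.zero_mem]
    · split_ifs
      exacts [hx, L.zero_mem]

/-- If `x` is `K`-proportionally commuting with each generator in `s`, then each element of the
algebra generated by `s` and `x` is a left polynomial in `x` over the algebra generated by `s`. -/
theorem exists_sum_of_mem_adjoin_insert {s : Set F} {x : F}
    (hs : ∀ a ∈ s, ∃ c : K, x * a = c • (a * x)) {b : F} (hb : b ∈ Algebra.adjoin K (insert x s)) :
    ∃ (N : ℕ) (c : ℕ → F), (∀ n, c n ∈ Algebra.adjoin K s) ∧ b = ∑ n ∈ range N, c n * x ^ n := by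
  set L := Algebra.adjoin K s
  have hL : ∀ a ∈ L, ∃ a' ∈ L, x * a = a' * x := by
    intro a ha
    refine Algebra.adjoin_induction (p := fun a _ => ∃ a' ∈ L, x * a = a' * x) ?_ ?_ ?_ ?_ ha
    · intro a ha
      obtain ⟨c, hc⟩ := hs a ha
      exact ⟨c • a, L.smul_mem (Algebra.subset_adjoin ha) c, by rw [hc, smul_mul_assoc]⟩
    · exact fun r => ⟨algebraMap K F r, L.algebraMap_mem r, (Algebra.commutes r x).symm⟩
    · rintro a b _ _ ⟨a', ha', e⟩ ⟨b', hb', e'⟩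
      exact ⟨a' + b', L.add_mem ha' hb', by rw [mul_add, e, e', add_mul]⟩
    · rintro a b _ _ ⟨a', ha', e⟩ ⟨b', hb', e'⟩
      exact ⟨a' * b', L.mul_mem ha' hb', by rw [← mul_assoc, e, mul_assoc, e', mul_assoc]⟩
  have hX : ∀ p : F[X], (∀ n, p.coeff n ∈ L) → ∃ p' : F[X], (∀ n, p'.coeff n ∈ L) ∧
      x * p.eval x = p'.eval x := by
    intro p hp
    choose f hf hfe using fun n => hL _ (hp n)
    refine ⟨∑ n ∈ range (p.natDegree + 1), monomial (n + 1) (f n), fun n => ?_, ?_⟩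
    · rw [finsetSum_coeff]
      refine L.sum_mem fun i _ => ?_
      rw [coeff_monomial]
      split_ifs
      exacts [hf i, L.zero_mem]
    · rw [eval_eq_sum_range, mul_sum, eval_finsetSum]
      refine sum_congr rfl fun n _ => ?_
      rw [eval_monomial, ← mul_assoc, hfe, pow_succ', mul_assoc]
  -- Evaluation at `x` is not multiplicative over a noncommutative ring. The induction therefore
  -- shows that left multiplication by `b` preserves the set of values of polynomials over `L`; the
  -- value `1` then gives `b` itself.
  have key : ∀ p : F[X], (∀ n, p.coeff n ∈ L) → ∃ p' : F[X], (∀ n, p'.coeff n ∈ L) ∧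
      b * p.eval x = p'.eval x := by
    refine Algebra.adjoin_induction (p := fun b _ => ∀ p : F[X], (∀ n, p.coeff n ∈ L) →
      ∃ p' : F[X], (∀ n, p'.coeff n ∈ L) ∧ b * p.eval x = p'.eval x) ?_ ?_ ?_ ?_ hb
    · rintro a (rfl | ha) p hp
      · exact hX p hp
      · exact ⟨C a * p, fun n => by
          rw [coeff_C_mul]; exact L.mul_mem (Algebra.subset_adjoin ha) (hp n), by rw [eval_C_mul]⟩
    · exact fun r p hp => ⟨C (algebraMap K F r) * p, fun n => by
          rw [coeff_C_mul]; exact L.mul_mem (L.algebraMap_mem r) (hp n), by rw [eval_C_mul]⟩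
    · intro a c _ _ iha ihc p hp
      obtain ⟨p1, h1, e1⟩ := iha p hp
      obtain ⟨p2, h2, e2⟩ := ihc p hp
      exact ⟨p1 + p2, fun n => by rw [coeff_add]; exact L.add_mem (h1 n) (h2 n),
        by rw [add_mul, e1, e2, eval_add]⟩
    · intro a c _ _ iha ihc p hp
      obtain ⟨p2, h2, e2⟩ := ihc p hp
      obtain ⟨p1, h1, e1⟩ := iha p2 h2
      exact ⟨p1, h1, by rw [mul_assoc, e2, e1]⟩
  obtain ⟨p, hp, e⟩ := key 1 fun n => by
    rw [coeff_one]; split_ifs; exacts [L.one_mem, L.zero_mem]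
  rw [eval_one, mul_one, eval_eq_sum_range] at e
  exact ⟨_, _, hp, e⟩

end SkewFree

/-! ### Right fractions with denominators the powers of one element. -/

section RightFractions

open Finset Polynomial

variable {K : Type*} [Field K] {F : Type*} [DivisionRing F] [Algebra K F]

/-- The powers of `x` satisfy the right Ore condition in the subalgebra `S`. -/
def IsRightOre (S : Subalgebra K F) (x : F) : Prop :=
  ∀ s ∈ S, ∀ n : ℕ, ∃ m : ℕ, ∃ t ∈ S, s * x ^ m = x ^ n * t

theorem isRightOre_adjoin {s : Set F} {x : F} (hs : ∀ a ∈ s, ∀ n : ℕ, ∃ m : ℕ,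
    ∃ t ∈ Algebra.adjoin K s, a * x ^ m = x ^ n * t) (hx : x ∈ s) :
    IsRightOre (Algebra.adjoin K s) x := by
  set L := Algebra.adjoin K s
  have hxL : x ∈ L := Algebra.subset_adjoin hx
  intro a ha
  refine Algebra.adjoin_induction (p := fun a _ => ∀ n : ℕ, ∃ m : ℕ, ∃ t ∈ L,
    a * x ^ m = x ^ n * t) hs ?_ ?_ ?_ ha
  · exact fun r n => ⟨n, algebraMap K F r, L.algebraMap_mem r, Algebra.commutes r _⟩
  · intro a b _ _ iha ihb n
    obtain ⟨m, t, ht, e⟩ := iha n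
    obtain ⟨k, u, hu, e'⟩ := ihb n
    refine ⟨m + k, t * x ^ k + u * x ^ m, L.add_mem (L.mul_mem ht (L.pow_mem hxL _))
      (L.mul_mem hu (L.pow_mem hxL _)), ?_⟩
    rw [add_mul, mul_add, ← mul_assoc, ← mul_assoc, ← e, ← e', mul_assoc, mul_assoc, ← pow_add,
      ← pow_add, Nat.add_comm k]
  · intro a b _ _ iha ihb n
    obtain ⟨m, t, ht, e⟩ := iha n
    obtain ⟨k, u, hu, e'⟩ := ihb m
    exact ⟨k, t * u, L.mul_mem ht hu, by rw [mul_assoc, e', ← mul_assoc, e, mul_assoc]⟩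

/-- The algebra of right fractions `s x^{-n}` with `s ∈ S`. -/
def rightFractions (S : Subalgebra K F) (x : F) (hx : x ∈ S) (h : IsRightOre S x) :
    Subalgebra K F where
  carrier := {z | ∃ n : ℕ, z * x ^ n ∈ S}
  mul_mem' := by
    rintro z w ⟨n, hn⟩ ⟨m, hm⟩
    obtain ⟨p, t, ht, e⟩ := h _ hm n
    refine ⟨m + p, ?_⟩
    rw [pow_add, mul_assoc, ← mul_assoc w, e, ← mul_assoc]
    exact S.mul_mem hn ht
  add_mem' := by
    rintro z w ⟨n, hn⟩ ⟨m, hm⟩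
    refine ⟨n + m, ?_⟩
    rw [add_mul, pow_add, ← mul_assoc, ← pow_add, Nat.add_comm n m, pow_add, ← mul_assoc]
    exact S.add_mem (S.mul_mem hn (S.pow_mem hx _)) (S.mul_mem hm (S.pow_mem hx _))
  algebraMap_mem' r := ⟨0, by simp⟩

/-- A relation over `L'` has finitely many coefficients, so one power `x ^ m` clears all
denominators. Moving it past `z ^ n` costs only a nonzero scalar, and a relation over `L` results.
-/
theorem IsSkewFree.of_le_rightFractions {L L' : Subalgebra K F} {x z : F} (h : IsSkewFree L z)
    (hx : x ∈ L) (hx0 : x ≠ 0) (hL : ∀ a ∈ L', ∃ n : ℕ, a * x ^ n ∈ L) {c : K} (hc0 : c ≠ 0)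
    (hc : z * x = c • (x * z)) : IsSkewFree L' z := by
  intro p hp h0
  choose f hf using fun n => hL _ (hp n)
  set N := p.natDegree + 1
  set m := (range N).sup f
  have hm : ∀ n < N, p.coeff n * x ^ m ∈ L := by
    intro n hn
    have hfm : f n ≤ m := le_sup (f := f) (mem_range.2 hn)
    rw [← Nat.add_sub_cancel' hfm, pow_add, ← mul_assoc]
    exact L.mul_mem (hf n) (L.pow_mem hx _)
  have e1 (n : ℕ) : z * x ^ n = c ^ n • (x ^ n * z) := by
    induction n with
    | zero => simp
    | succ n ih =>
      rw [pow_succ, ← mul_assoc, ih, smul_mul_assoc, mul_assoc, hc, mul_smul_comm, smul_smul,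
        ← pow_succ, mul_assoc]
  have e2 (n : ℕ) : z ^ n * x ^ m = (c ^ m) ^ n • (x ^ m * z ^ n) := by
    induction n with
    | zero => simp
    | succ n ih =>
      rw [pow_succ, mul_assoc, e1, mul_smul_comm, ← mul_assoc, ih, smul_mul_assoc, smul_smul,
        ← pow_succ', mul_assoc]
  have h1 : ∑ n ∈ range N, ((c ^ m) ^ n • (p.coeff n * x ^ m)) * z ^ n = 0 := by
    rw [eval_eq_sum_range] at h0
    have h2 := congrArg (· * x ^ m) h0
    simp only [zero_mul, sum_mul] at h2
    rw [← h2]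
    refine sum_congr rfl fun n _ => ?_
    rw [mul_assoc (p.coeff n), e2, mul_smul_comm, smul_mul_assoc, mul_assoc]
  ext n
  by_cases hn : n < N
  · have h3 := h.sum_eq_zero (fun n hn => L.smul_mem (hm n hn) _) h1 hn
    rw [smul_eq_zero_iff_right (pow_ne_zero _ (pow_ne_zero _ hc0)),
      mul_eq_zero_iff_right (pow_ne_zero _ hx0)] at h3
    exact h3
  · exact coeff_eq_zero_of_natDegree_lt (by omega)

/-- `Q` is the localization of `P` at the powers of `x`, cut down to `B`. Since `x ∉ P`, powers of
`x` can be cancelled from members of `P` on either side. -/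
theorem exists_completelyPrime_of_rightFractions {S B : Subalgebra K F} {x : F} (hx : x ∈ S)
    (hx0 : x ≠ 0) (h : IsRightOre S x) (hB : B ≤ rightFractions S x hx h) {P : TwoSidedIdeal S}
    (hP : P.IsCompletelyPrime) (hxP : (⟨x, hx⟩ : S) ∉ P) :
    ∃ Q : TwoSidedIdeal B, Q.IsCompletelyPrime ∧
      ∀ a : B, a ∈ Q ↔ ∃ p ∈ P, ∃ n : ℕ, (a : F) = (p : F) * (x ^ n)⁻¹ := by
  have h1 : (1 : S) ∉ P := fun h1 => hP.1 (by
    rw [eq_top_iff]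
    intro a _
    simpa using P.mul_mem_left a 1 h1)
  have hpow : ∀ n : ℕ, (⟨x, hx⟩ : S) ^ n ∉ P := by
    intro n
    induction n with
    | zero => simpa using h1
    | succ n ih =>
      intro hn
      rw [pow_succ] at hn
      exact (hP.2 _ _ hn).elim ih hxP
  have hmr (a : S) (n : ℕ) : a * (⟨x, hx⟩ : S) ^ n ∈ P → a ∈ P :=
    fun h => (hP.2 _ _ h).resolve_right (hpow n)
  have hml (a : S) (n : ℕ) : (⟨x, hx⟩ : S) ^ n * a ∈ P → a ∈ P :=
    fun h => (hP.2 _ _ h).resolve_left (hpow n)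
  have hO (s : S) (n : ℕ) : ∃ m : ℕ, ∃ t : S, s * (⟨x, hx⟩ : S) ^ m = (⟨x, hx⟩ : S) ^ n * t := by
    obtain ⟨m, t, ht, e⟩ := h s s.2 n
    exact ⟨m, ⟨t, ht⟩, Subtype.ext e⟩
  let I (z : F) : Prop := ∃ p ∈ P, ∃ n : ℕ, z * x ^ n = (p : F)
  have hI (z : F) : I z ↔ ∃ p ∈ P, ∃ n : ℕ, z = (p : F) * (x ^ n)⁻¹ := by
    simp only [I, eq_mul_inv_iff_mul_eq₀ (pow_ne_zero _ hx0)]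
  have hadd : ∀ z w, I z → I w → I (z + w) := by
    rintro z w ⟨p, hp, n, e⟩ ⟨r, hr, m, e'⟩
    refine ⟨p * ⟨x, hx⟩ ^ m + r * ⟨x, hx⟩ ^ n, P.add_mem (P.mul_mem_right _ _ hp)
      (P.mul_mem_right _ _ hr), n + m, ?_⟩
    push_cast
    rw [← e, ← e', add_mul, pow_add, mul_assoc z, mul_assoc w, ← pow_add, ← pow_add, Nat.add_comm n]
  have hleft : ∀ b ∈ B, ∀ z, I z → I (b * z) := by
    rintro b hb z ⟨p, hp, m, e⟩
    obtain ⟨n, hn⟩ := hB hb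
    obtain ⟨k, t, ht⟩ := hO p n
    have htP : t ∈ P := hml t n (ht ▸ P.mul_mem_right _ _ hp)
    refine ⟨⟨_, hn⟩ * t, P.mul_mem_left _ _ htP, m + k, ?_⟩
    have ht' := congrArg (Subtype.val) ht
    push_cast at ht' ⊢
    rw [pow_add, mul_assoc, ← mul_assoc z, e, ht', mul_assoc]
  have hright : ∀ b ∈ B, ∀ z, I z → I (z * b) := by
    rintro b hb z ⟨p, hp, m, e⟩
    obtain ⟨n, hn⟩ := hB hb
    obtain ⟨k, t, ht⟩ := hO ⟨_, hn⟩ m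
    refine ⟨p * t, P.mul_mem_right _ _ hp, n + k, ?_⟩
    have ht' := congrArg (Subtype.val) ht
    push_cast at ht' ⊢
    rw [pow_add, mul_assoc, ← mul_assoc b, ht', ← mul_assoc, e]
  have hI1 : ¬ I 1 := by
    rintro ⟨p, hp, n, e⟩
    refine hpow n ?_
    rw [one_mul] at e
    rwa [show (⟨x, hx⟩ : S) ^ n = p from Subtype.ext e]
  let Q : TwoSidedIdeal B := TwoSidedIdeal.mk' {a : B | I a}
    ⟨0, P.zero_mem, 0, by simp⟩ (fun {a b} ha hb => hadd a b ha hb)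
    (fun {a} ha => by
      have := hleft (-1) (B.neg_mem B.one_mem) a ha
      simpa using this)
    (fun {a b} hb => hleft a a.2 b hb) (fun {a b} ha => hright b b.2 a ha)
  have hQ (a : B) : a ∈ Q ↔ I a := by simp [Q, TwoSidedIdeal.mem_mk']
  refine ⟨Q, ⟨?_, ?_⟩, fun a => by rw [hQ, hI]⟩
  · intro hQt
    exact hI1 ((hQ 1).1 (hQt ▸ trivial))
  · intro a b hab
    rw [hQ] at hab ⊢
    rw [hQ]
    obtain ⟨p, hp, k, e⟩ := hab
    obtain ⟨n, hn⟩ := hB a.2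
    obtain ⟨m, hm⟩ := hB b.2
    -- With `s = a x^n` and `u = b x^m`, the Ore condition `u x^l = x^n t` gives `s t = a b
    -- x^{m+l}`, whence `s t ∈ P`. If `t ∈ P` then `u x^l ∈ P`, so `u ∈ P`.
    obtain ⟨l, t, ht⟩ := hO ⟨_, hm⟩ n
    have ht' := congrArg (Subtype.val) ht
    push_cast at ht' e
    have e2 : (⟨_, hn⟩ * t * ⟨x, hx⟩ ^ k : S) = p * ⟨x, hx⟩ ^ (m + l) := by
      apply Subtype.ext
      push_cast
      rw [mul_assoc (a : F), ← ht', ← e, pow_add]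
      have hk : x ^ k * (x ^ m * x ^ l) = x ^ m * x ^ l * x ^ k := by
        simp only [← pow_add]; congr 1; omega
      simp only [mul_assoc] at hk ⊢
      rw [hk]
    have h3 := hmr _ k (e2 ▸ P.mul_mem_right _ _ hp)
    rcases hP.2 _ _ h3 with h4 | h4
    · exact Or.inl ⟨_, h4, n, rfl⟩
    · refine Or.inr ⟨_, hmr ⟨_, hm⟩ l ?_, m, rfl⟩
      rw [ht]
      exact P.mul_mem_left _ _ h4

end RightFractions

/-! ### Leading coefficients of the deletion map, and the Ore condition. -/

section DeletionMap

open Finset Polynomial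

variable {K : Type*} [Field K] {R : Type*} [Ring R] [Algebra K R] {F : Type*} [DivisionRing F]
  [Algebra K F] {q : K} {σ : R ≃ₐ[K] R} {δ : R →ₗ[K] R} {d : ℕ → R →ₗ[K] R} {φ : R →ₐ[K] F} {x : F}

/-- Multiplication by a large power `x ^ m` turns the relation into one over the image of `φ`, where
the powers of `x` are independent. Its top coefficient is the claim. The case `N = 0` gives
injectivity. -/
theorem deletionFun_sum_lead (H : IsHigherSkewDerivation q σ δ d) (hq : q ≠ 0)
    (hd : IsLocallyNilpotentSeq d) (hx : x ≠ 0) (hfree : IsSkewFree φ.range x) (N : ℕ) (r : ℕ → R)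
    (h : ∑ n ∈ range (N + 1), deletionFun q σ d φ x (r n) * x ^ n = 0) : φ (r N) = 0 := by
  choose f hf using fun n => hd (r n)
  set m := (range (N + 1)).sup f
  have hm : ∀ n < N + 1, ∀ k, m < k → d k (r n) = 0 := fun n hn k hk =>
    hf n k ((le_sup (f := f) (mem_range.2 hn)).trans hk.le)
  let p : F[X] := ∑ n ∈ range (N + 1), ∑ i ∈ range (m + 1),
    monomial (m - i + n) (φ (deletionCoeff q i • d i ((σ.symm ^ i) (r n))))
  have hp : p = 0 := by
    refine hfree p (fun k => ?_) ?_
    · simp only [p, finsetSum_coeff, coeff_monomial]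
      refine Subalgebra.sum_mem _ fun n _ => Subalgebra.sum_mem _ fun i _ => ?_
      split_ifs
      exacts [⟨_, rfl⟩, Subalgebra.zero_mem _]
    · have h2 := congrArg (· * x ^ m) h
      simp only [zero_mul, sum_mul] at h2
      simp only [p, eval_finsetSum, eval_monomial]
      rw [← h2]
      refine sum_congr rfl fun n hn => ?_
      rw [mul_assoc, ← pow_add, Nat.add_comm n m, pow_add, ← mul_assoc,
        deletionFun_mul_pow H hq hx (hm n (mem_range.1 hn)), sum_mul]
      exact sum_congr rfl fun i _ => by rw [mul_assoc, pow_add]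
  have h3 := congrArg (fun p => coeff p (m + N)) hp
  simp only [p, finsetSum_coeff, coeff_monomial, coeff_zero] at h3
  -- For `i ≤ m` and `n ≤ N`, the exponent `m - i + n` equals `m + N` only if `i = 0` and `n = N`.
  rw [sum_eq_single N, sum_eq_single 0] at h3
  · simpa [deletionCoeff, H.zero] using h3
  · intro i hi hi0
    rw [mem_range] at hi
    rw [if_neg (by omega)]
  · simp
  · intro n hn hnN
    rw [mem_range] at hn
    refine sum_eq_zero fun i _ => ?_
    rw [if_neg (by omega)]
  · simp

theorem deletionHom_injective (H : IsHigherSkewDerivation q σ δ d) (hq : q ≠ 0) (hq1 : q ≠ 1)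
    (hd : IsLocallyNilpotentSeq d) (hit : IsIterativeSeq q d) (hx : x ≠ 0)
    (hc : ∀ r, x * φ r = φ (σ r) * x + φ (δ r)) (hφ : Function.Injective φ)
    (hfree : IsSkewFree φ.range x) : Function.Injective (deletionHom H hq hq1 hd hit hx hc) := by
  rw [injective_iff_map_eq_zero]
  intro a ha
  have ha' : deletionFun q σ d φ x a = 0 := ha
  have h := deletionFun_sum_lead H hq hd hx hfree 0 (fun _ => a) (by simpa using ha')
  exact (map_eq_zero_iff _ hφ).1 h

theorem isSkewFree_deletionHom (H : IsHigherSkewDerivation q σ δ d) (hq : q ≠ 0) (hq1 : q ≠ 1)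
    (hd : IsLocallyNilpotentSeq d) (hit : IsIterativeSeq q d) (hx : x ≠ 0)
    (hc : ∀ r, x * φ r = φ (σ r) * x + φ (δ r)) (hφ : Function.Injective φ)
    (hfree : IsSkewFree φ.range x) : IsSkewFree (deletionHom H hq hq1 hd hit hx hc).range x := by
  intro p hp h0
  choose r hr using hp
  rw [eval_eq_sum_range] at h0
  simp only [← hr] at h0
  have h := deletionFun_sum_lead H hq hd hx hfree p.natDegree r h0
  rw [map_eq_zero_iff _ hφ] at h
  rw [← leadingCoeff_eq_zero, leadingCoeff, ← hr, h]
  exact map_zero (deletionHom H hq hq1 hd hit hx hc)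

/-- The local nilpotency of the higher derivation gives the right Ore condition for the powers of
`x`. -/
theorem exists_mul_pow_eq_pow_mul (H : IsHigherSkewDerivation q σ δ d) (hq : q ≠ 0)
    (hd : IsLocallyNilpotentSeq d) (hit : IsIterativeSeq q d)
    (hc : ∀ r, x * φ r = φ (σ r) * x + φ (δ r)) {S : Subalgebra K F} (hS : φ.range ≤ S)
    (hxS : x ∈ S) (a : R) (n : ℕ) : ∃ m : ℕ, ∃ t ∈ S, φ a * x ^ m = x ^ n * t := by
  -- Double induction, on the nilpotency order `k` and the exponent `n`, through `φ(a) x = x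
  -- φ(σ⁻¹(a)) - φ(δ(σ⁻¹(a)))`. The first term lowers `n`. The second lowers `k`, since `d_i δ` is a
  -- multiple of `d_{i+1}`.
  have key : ∀ k n : ℕ, ∀ a : R, (∀ i, k ≤ i → d i a = 0) →
      ∃ t ∈ S, φ a * x ^ (n + k) = x ^ n * t := by
    intro k
    induction k with
    | zero =>
      intro n a ha
      have h0 := ha 0 le_rfl
      rw [H.zero, LinearMap.id_apply] at h0
      exact ⟨0, S.zero_mem, by simp [h0]⟩
    | succ k ihk =>
      intro n
      induction n with
      | zero =>
        intro a _
        exact ⟨φ a * x ^ (0 + (k + 1)), S.mul_mem (hS ⟨a, rfl⟩) (S.pow_mem hxS _), by simp⟩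
      | succ n ihn =>
        intro a ha
        have hs : ∀ i, d i a = 0 → d i (σ.symm a) = 0 := fun i hi => by
          simpa using H.eq_zero_of_symm_pow hq i 1 a hi
        obtain ⟨t, ht, e⟩ := ihn (σ.symm a) fun i hi => hs i (ha i hi)
        obtain ⟨u, hu, e'⟩ := ihk (n + 1) (δ (σ.symm a)) fun i hi => by
          rw [← H.one, hit i 1, hs _ (ha _ (by omega)), smul_zero]
        have h1 := hc (σ.symm a)
        rw [AlgEquiv.apply_symm_apply, ← sub_eq_iff_eq_add] at h1
        refine ⟨t - u, S.sub_mem ht hu, ?_⟩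
        rw [show n + 1 + (k + 1) = (n + (k + 1)) + 1 by omega, pow_succ', ← mul_assoc, ← h1,
          sub_mul, mul_assoc, e, show n + (k + 1) = n + 1 + k by omega, e', mul_sub, pow_succ',
          mul_assoc, mul_assoc]
  obtain ⟨m, hm⟩ := hd a
  obtain ⟨t, ht, e⟩ := key m n a hm
  exact ⟨_, t, ht, e⟩

end DeletionMap

/-! ### Algebras generated by initial segments, and homomorphisms given by graphs. -/

section Tower

variable {K : Type*} [Field K] {N : ℕ} {A F Q : Type*} [Ring A] [Algebra K A] [Ring F] [Algebra K F]
  [Ring Q] [Algebra K Q]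

theorem lowerSubalgebra_mono (x : Fin N → A) {m n : ℕ} (h : m ≤ n) :
    lowerSubalgebra K x m ≤ lowerSubalgebra K x n :=
  Algebra.adjoin_mono (Set.image_mono fun _ hi => lt_of_lt_of_le hi h)

theorem lowerSubalgebra_eq_adjoin_range (x : Fin N → A) :
    lowerSubalgebra K x N = Algebra.adjoin K (Set.range x) := by
  rw [lowerSubalgebra, ← Set.image_univ]
  congr 2
  ext i
  simp

theorem lowerSubalgebra_succ (x : Fin N → A) (l : Fin N) :
    lowerSubalgebra K x (l + 1) =
      Algebra.adjoin K (insert (x l) (x '' {i : Fin N | (i : ℕ) < l})) := by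
  rw [lowerSubalgebra, ← Set.image_insert_eq]
  congr 2
  ext i
  simp only [Set.mem_ofPred_eq, Set.mem_insert_iff, Fin.ext_iff]
  omega

theorem lowerSubalgebra_range {X : Fin N → A} {x : Fin N → F} {m : ℕ}
    (φ : lowerSubalgebra K X m →ₐ[K] F)
    (h : ∀ (i : Fin N) (hi : (i : ℕ) < m), φ ⟨X i, mem_lowerSubalgebra K X hi⟩ = x i) :
    φ.range = lowerSubalgebra K x m := by
  apply le_antisymm
  · rintro _ ⟨⟨a, ha⟩, rfl⟩
    refine Algebra.adjoin_induction (p := fun a ha => φ ⟨a, ha⟩ ∈ lowerSubalgebra K x m)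
      ?_ ?_ ?_ ?_ ha
    · rintro _ ⟨i, hi, rfl⟩
      rw [h i hi]
      exact mem_lowerSubalgebra K x hi
    · intro r
      rw [show (⟨algebraMap K A r, _⟩ : lowerSubalgebra K X m) = algebraMap K _ r from rfl,
        AlgHom.commutes]
      exact Subalgebra.algebraMap_mem _ r
    · intro a b ha hb h1 h2
      rw [show (⟨a + b, _⟩ : lowerSubalgebra K X m) = ⟨a, ha⟩ + ⟨b, hb⟩ from rfl, map_add]
      exact add_mem h1 h2
    · intro a b ha hb h1 h2
      rw [show (⟨a * b, _⟩ : lowerSubalgebra K X m) = ⟨a, ha⟩ * ⟨b, hb⟩ from rfl, map_mul]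
      exact mul_mem h1 h2
  · rw [lowerSubalgebra, Algebra.adjoin_le_iff]
    rintro _ ⟨i, hi, rfl⟩
    exact ⟨⟨X i, mem_lowerSubalgebra K X hi⟩, h i hi⟩

theorem lowerSubalgebra_hom_ext {X : Fin N → A} {m : ℕ} {φ θ : lowerSubalgebra K X m →ₐ[K] F}
    (h : ∀ (i : Fin N) (hi : (i : ℕ) < m), φ ⟨X i, mem_lowerSubalgebra K X hi⟩ =
      θ ⟨X i, mem_lowerSubalgebra K X hi⟩) : φ = θ := by
  refine AlgHom.adjoin_ext ?_
  rintro _ ⟨i, hi, rfl⟩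
  exact h i hi

/-- A correspondence `y_i ↦ z_i` that is well defined on the algebra generated by the first `m`
of the `y_i` is well defined on the algebra generated by more of them, if the further variables
quasi-commute with the earlier ones and are skew free over them. -/
theorem graph_functional {y : Fin N → F} {z : Fin N → Q} {lam : Matrix (Fin N) (Fin N) K} {m : ℕ}
    (hy : ∀ l i : Fin N, m ≤ l → i < l → y l * y i = lam l i • (y i * y l))
    (hz : ∀ l i : Fin N, m ≤ l → i < l → z l * z i = lam l i • (z i * z l))
    (hfree : ∀ l : Fin N, m ≤ l → IsSkewFree (lowerSubalgebra K y l) (y l))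
    (hm : ∀ p ∈ lowerSubalgebra K (fun i => (y i, z i)) m, p.1 = 0 → p.2 = 0) {n : ℕ} (hmn : m ≤ n)
    (hn : n ≤ N) : ∀ p ∈ lowerSubalgebra K (fun i => (y i, z i)) n, p.1 = 0 → p.2 = 0 := by
  induction n, hmn using Nat.le_induction with
  | base => exact hm
  | succ l hl ih =>
    intro p hp hp0
    have ih := ih (by omega)
    have e := lowerSubalgebra_succ (K := K) (fun i => (y i, z i)) ⟨l, hn⟩
    rw [e] at hp
    obtain ⟨M, c, hc, rfl⟩ := exists_sum_of_mem_adjoin_insert (K := K) (by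
      rintro _ ⟨i, hi, rfl⟩
      exact ⟨lam ⟨l, hn⟩ i, Prod.ext (hy ⟨l, hn⟩ i hl hi) (hz ⟨l, hn⟩ i hl hi)⟩) hp
    have hfst : ∀ n, (c n).1 ∈ lowerSubalgebra K y l := by
      intro n
      have h1 : (AlgHom.fst K F Q) (c n) ∈
          (lowerSubalgebra K (fun i => (y i, z i)) l).map (AlgHom.fst K F Q) := ⟨_, hc n, rfl⟩
      rw [lowerSubalgebra, AlgHom.map_adjoin, ← Set.image_comp] at h1
      exact h1
    rw [Prod.fst_sum] at hp0
    rw [Prod.snd_sum]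
    refine Finset.sum_eq_zero fun n hn' => ?_
    -- `p` is a left polynomial in the pair `(y_l, z_l)`. Skew freeness kills the first components
    -- of its coefficients, so the induction hypothesis kills the second ones.
    have h2 := (hfree ⟨l, hn⟩ hl).sum_eq_zero (fun n _ => hfst n) hp0 (Finset.mem_range.1 hn')
    rw [Prod.snd_mul, ih _ (hc n) h2, zero_mul]

/-- The hypothesis says that the first projection is injective on the subalgebra of `F × Q`
generated by the pairs; its inverse followed by the second projection is the map. -/
theorem exists_algHom_of_graph {ι : Type*} {y : ι → F} {z : ι → Q}
    (h : ∀ p ∈ Algebra.adjoin K (Set.range fun i => (y i, z i)), p.1 = 0 → p.2 = 0) :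
    ∃ g : Algebra.adjoin K (Set.range y) →ₐ[K] Q,
      ∀ i, g ⟨y i, Algebra.subset_adjoin ⟨i, rfl⟩⟩ = z i := by
  set G := Algebra.adjoin K (Set.range fun i => (y i, z i)) with hG
  let π : G →ₐ[K] F := (AlgHom.fst K F Q).comp G.val
  have hπ : Function.Injective π := by
    rw [injective_iff_map_eq_zero]
    rintro ⟨p, hp⟩ h0
    exact Subtype.ext (Prod.ext h0 (h p hp h0))
  have hr : Algebra.adjoin K (Set.range y) ≤ π.range := by
    rw [Algebra.adjoin_le_iff]
    rintro _ ⟨i, rfl⟩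
    exact ⟨⟨(y i, z i), Algebra.subset_adjoin ⟨i, rfl⟩⟩, rfl⟩
  refine ⟨((AlgHom.snd K F Q).comp G.val).comp
    ((AlgEquiv.ofInjective π hπ).symm.toAlgHom.comp (Subalgebra.inclusion hr)), fun i => ?_⟩
  have e : (AlgEquiv.ofInjective π hπ).symm ⟨y i, hr (Algebra.subset_adjoin ⟨i, rfl⟩)⟩ =
      ⟨(y i, z i), Algebra.subset_adjoin ⟨i, rfl⟩⟩ := by
    rw [AlgEquiv.symm_apply_eq]
    rfl
  exact congrArg (fun p : G => (p : F × Q).2) e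

end Tower

/-! ### Transfer of completely prime ideals. -/

section CompletelyPrime

variable {R S : Type*} [Ring R] [Ring S]

theorem TwoSidedIdeal.ne_top_iff_one_notMem {P : TwoSidedIdeal R} : P ≠ ⊤ ↔ (1 : R) ∉ P := by
  rw [not_iff_not]
  refine ⟨fun h => h ▸ trivial, fun h => ?_⟩
  rw [eq_top_iff]
  intro a _
  simpa using P.mul_mem_left a 1 h

theorem TwoSidedIdeal.IsCompletelyPrime.map_of_bijective {P : TwoSidedIdeal R}
    (hP : P.IsCompletelyPrime) (f : R →+* S) (hf : Function.Bijective f) :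
    (P.map f).IsCompletelyPrime := by
  have key (a : R) : f a ∈ P.map f ↔ a ∈ P := by
    refine ⟨fun h => ?_, fun h => TwoSidedIdeal.subset_span ⟨a, h, rfl⟩⟩
    let e := RingEquiv.ofBijective f hf
    have h1 : P.map f ≤ P.comap e.symm := by
      refine TwoSidedIdeal.span_le.2 ?_
      rintro _ ⟨b, hb, rfl⟩
      change f b ∈ P.comap e.symm
      rw [TwoSidedIdeal.mem_comap, show e.symm (f b) = b from e.symm_apply_apply b]
      exact hb
    have h2 := h1 h
    rwa [TwoSidedIdeal.mem_comap, show e.symm (f a) = a from e.symm_apply_apply a] at h2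
  constructor
  · rw [ne_top_iff_one_notMem, ← map_one f, key]
    exact ne_top_iff_one_notMem.1 hP.1
  · intro a b hab
    obtain ⟨a, rfl⟩ := hf.2 a
    obtain ⟨b, rfl⟩ := hf.2 b
    rw [← map_mul, key] at hab
    simpa only [key] using hP.2 a b hab

/-- `Q` is the kernel of `S → R/I → R/P`, so `S/Q` embeds in the domain `R/P`. Here `I ≤ P` makes
membership in `P` depend only on the class modulo `I`. -/
theorem TwoSidedIdeal.IsCompletelyPrime.exists_preimage {P I : TwoSidedIdeal R}
    (hP : P.IsCompletelyPrime) (hI : I ≤ P) (g : S →+* I.ringCon.Quotient) :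
    ∃ Q : TwoSidedIdeal S, Q.IsCompletelyPrime ∧ ∀ a, a ∈ Q ↔ ∃ p ∈ P, g a = I.ringCon.mk' p := by
  have hmk : ∀ {a p : R}, p ∈ P → I.ringCon.mk' a = I.ringCon.mk' p → a ∈ P := by
    intro a p hp h
    have h1 : a - p ∈ P := hI ((I.rel_iff _ _).1 ((RingCon.eq I.ringCon).1 h))
    simpa using P.add_mem h1 hp
  have hs : Function.Surjective I.ringCon.mk' := RingCon.mk'_surjective _
  let Q : TwoSidedIdeal S := TwoSidedIdeal.mk' {a | ∃ p ∈ P, g a = I.ringCon.mk' p}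
    ⟨0, P.zero_mem, by simp only [map_zero]⟩
    (by
      rintro a b ⟨p, hp, e⟩ ⟨r, hr, e'⟩
      exact ⟨p + r, P.add_mem hp hr, by rw [map_add, map_add, e, e']⟩)
    (by
      rintro a ⟨p, hp, e⟩
      exact ⟨-p, P.neg_mem hp, by rw [map_neg, map_neg, e]⟩)
    (by
      rintro b a ⟨p, hp, e⟩
      obtain ⟨s, hs⟩ := hs (g b)
      exact ⟨s * p, P.mul_mem_left _ _ hp, by rw [map_mul, map_mul, e, hs]⟩)
    (by
      rintro a b ⟨p, hp, e⟩
      obtain ⟨s, hs⟩ := hs (g b)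
      exact ⟨p * s, P.mul_mem_right _ _ hp, by rw [map_mul, map_mul, e, hs]⟩)
  have hQ (a : S) : a ∈ Q ↔ ∃ p ∈ P, g a = I.ringCon.mk' p := by simp [Q, TwoSidedIdeal.mem_mk']
  refine ⟨Q, ⟨?_, ?_⟩, hQ⟩
  · rw [ne_top_iff_one_notMem, hQ]
    rintro ⟨p, hp, e⟩
    rw [map_one, ← map_one I.ringCon.mk'] at e
    exact ne_top_iff_one_notMem.1 hP.1 (hmk hp e)
  · intro a b hab
    rw [hQ] at hab ⊢
    rw [hQ]
    obtain ⟨p, hp, e⟩ := hab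
    obtain ⟨s, hs'⟩ := hs (g a)
    obtain ⟨t, ht'⟩ := hs (g b)
    rw [map_mul, ← hs', ← ht', ← map_mul] at e
    rw [← hs', ← ht']
    exact (hP.2 s t (hmk hp e)).imp (fun h => ⟨s, h, rfl⟩) (fun h => ⟨t, h, rfl⟩)

end CompletelyPrime

/-! ### One deletion step inside the tower. -/

namespace QuantumNilpotent

open Finset Polynomial

variable {K : Type*} [Field K] {N : ℕ} {A : Type*} [Ring A] [Algebra K A]
  {F : Type*} [DivisionRing F] [Algebra K F] (D : QuantumNilpotent K N A)

/-- The elements `x_1, …, x_N` of the division algebra `F` satisfy the relations in which the derivations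
of index greater than `m` are deleted, and no others. -/
structure IsDeleted (x : Fin N → F) (m : ℕ) : Prop where
  exists_hom : ∃ φ : lowerSubalgebra K D.X m →ₐ[K] F, Function.Injective φ ∧
    ∀ (i : Fin N) (hi : (i : ℕ) < m), φ ⟨D.X i, mem_lowerSubalgebra K D.X hi⟩ = x i
  comm : ∀ l i : Fin N, m ≤ l → i < l → x l * x i = D.lam l i • (x i * x l)
  free : ∀ l : Fin N, m ≤ l → IsSkewFree (lowerSubalgebra K x l) (x l)

/-- The embedding `φ` of `A_{j-1}` and the elements `x_1, …, x_N` of `F` are ready for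
the deletion of the derivation `δ_j`. -/
structure IsStepEmbedding (x : Fin N → F) (j : Fin N)
    (φ : lowerSubalgebra K D.X j →ₐ[K] F) : Prop where
  pos : 0 < (j : ℕ)
  injective : Function.Injective φ
  apply_X : ∀ (i : Fin N) (hi : i < j), φ ⟨D.X i, mem_lowerSubalgebra K D.X hi⟩ = x i
  ne_zero : x j ≠ 0
  mul_apply : ∀ r, x j * φ r = φ (D.σ j r) * x j + φ (D.δ j r)
  free : IsSkewFree φ.range (x j)
  comm : ∀ l i : Fin N, j < l → i < l → x l * x i = D.lam l i • (x i * x l)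
  free_of_lt : ∀ l : Fin N, j < l → IsSkewFree (lowerSubalgebra K x l) (x l)

variable {D} {x : Fin N → F} {j : Fin N}

/-- The embedding of `A_j = A_{j-1}[X_j; σ_j, δ_j]` is restricted to `A_{j-1}`. It carries over the
Ore relation, and the basis of powers of `X_j` yields skew freeness. -/
theorem IsDeleted.exists_stepEmbedding (h : D.IsDeleted x (j + 1)) (hj : 0 < (j : ℕ)) :
    ∃ φ, D.IsStepEmbedding x j φ := by
  obtain ⟨φ, hφ, hX⟩ := h.exists_hom
  have H := D.ore j
  have hle := lowerSubalgebra_mono (K := K) D.X (Nat.le_add_right (j : ℕ) 1)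
  have := D.nontrivial
  obtain ⟨ι, hιv⟩ : ∃ ι : lowerSubalgebra K D.X j →ₐ[K] lowerSubalgebra K D.X (j + 1),
      ∀ a, (ι a : A) = a := ⟨Subalgebra.inclusion hle, Subalgebra.coe_inclusion hle⟩
  have hι : Function.Injective ι := fun a b hab => by
    rw [Subtype.ext_iff, ← hιv a, ← hιv b, hab]
  have hφι : Function.Injective (φ.comp ι) := hφ.comp hι
  obtain ⟨z, hz⟩ : ∃ z : lowerSubalgebra K D.X (j + 1), (z : A) = D.X j :=
    ⟨⟨D.X j, mem_lowerSubalgebra K D.X (Nat.lt_succ_self _)⟩, rfl⟩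
  have hX' : ∀ (i : Fin N) (hi : (i : ℕ) < j + 1) (a : lowerSubalgebra K D.X (j + 1)),
      (a : A) = D.X i → φ a = x i := by
    intro i hi a ha
    rw [← hX i hi]
    exact congrArg φ (Subtype.ext ha)
  have hxj : φ z = x j := hX' j (Nat.lt_succ_self _) z hz
  have hfree : IsSkewFree (φ.comp ι).range (x j) := by
    intro p hp h0
    have hp' : ∀ n, ∃ r, φ (ι r) = p.coeff n := hp
    choose r hr using hp'
    have hr0 : ∀ n, r n ≠ 0 → n ∈ p.support := fun n hn => by
      rw [mem_support_iff, ← hr]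
      exact (map_ne_zero_iff (φ.comp ι) hφι).2 hn
    have h1 : φ (∑ n ∈ p.support, ι (r n) * z ^ n) = 0 := by
      rw [← h0, eval_eq_sum, Polynomial.sum, map_sum]
      refine sum_congr rfl fun n _ => ?_
      rw [map_mul, map_pow, hxj, hr]
    rw [map_eq_zero_iff _ hφ] at h1
    have h2 := congrArg Subtype.val h1
    rw [AddSubmonoidClass.coe_finsetSum, ZeroMemClass.coe_zero] at h2
    have hs : (Finsupp.onFinset p.support r hr0).sum (fun n r => (r : A) * D.X j ^ n) = 0 := by
      rw [Finsupp.onFinset_sum _ (by simp), ← h2]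
      refine sum_congr rfl fun n _ => ?_
      rw [Subalgebra.coe_mul, Subalgebra.coe_pow, hz, hιv]
    have h3 := (H.basis 0 (zero_mem _)).unique hs.symm (y₂ := 0) (by simp)
    ext n
    have h4 : r n = 0 := DFunLike.congr_fun h3 n
    rw [← hr, h4, map_zero, map_zero, coeff_zero]
  refine ⟨φ.comp ι, hj, hφι, ?_, ?_, ?_, hfree, fun l i hl => h.comm l i hl, h.free⟩
  · intro i hi
    exact hX' i (Nat.lt_succ_of_lt hi) _ (hιv _)
  · intro h0
    have h1 := hfree Polynomial.X (fun n => ?_) (by rw [eval_X, h0])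
    · exact X_ne_zero h1
    · rw [coeff_X]
      split_ifs
      exacts [one_mem _, zero_mem _]
  · intro r
    have h1 : z * ι r = ι (D.σ j r) * z + ι (D.δ j r) := by
      apply Subtype.ext
      rw [Subalgebra.coe_add, Subalgebra.coe_mul, Subalgebra.coe_mul, hz, hιv, hιv, hιv]
      exact H.comm r
    rw [← hxj, AlgHom.comp_apply, AlgHom.comp_apply, AlgHom.comp_apply, ← map_mul, h1, map_add,
      map_mul]

namespace IsStepEmbedding

variable {φ : lowerSubalgebra K D.X j →ₐ[K] F}

/-- The embedding of `A_{j-1}` that is obtained by deleting `δ_j`. -/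
noncomputable def hom (h : D.IsStepEmbedding x j φ) : lowerSubalgebra K D.X j →ₐ[K] F :=
  deletionHom (D.higher j h.pos) (D.qSkew j h.pos).1 (D.qSkew j h.pos).2.1
    (D.locallyNilpotent j h.pos) (D.iterative j h.pos) h.ne_zero h.mul_apply

theorem hom_injective (h : D.IsStepEmbedding x j φ) : Function.Injective h.hom :=
  deletionHom_injective _ _ _ _ _ _ _ h.injective h.free

/-- The elements `y_1, …, y_N` that are obtained by deleting `δ_j`. -/
noncomputable def deleted (h : D.IsStepEmbedding x j φ) (i : Fin N) : F :=
  if hi : i < j then h.hom ⟨D.X i, mem_lowerSubalgebra K D.X hi⟩ else x i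

theorem hom_X (h : D.IsStepEmbedding x j φ) (i : Fin N) (hi : i < j) :
    h.hom ⟨D.X i, mem_lowerSubalgebra K D.X hi⟩ = h.deleted i := by
  rw [deleted, dif_pos hi]

theorem deleted_of_le (h : D.IsStepEmbedding x j φ) {i : Fin N} (hi : j ≤ i) :
    h.deleted i = x i := by
  rw [deleted, dif_neg (not_lt.2 hi)]

theorem range_eq (h : D.IsStepEmbedding x j φ) : φ.range = lowerSubalgebra K x j :=
  lowerSubalgebra_range φ h.apply_X

theorem range_hom (h : D.IsStepEmbedding x j φ) :
    h.hom.range = lowerSubalgebra K h.deleted j :=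
  lowerSubalgebra_range h.hom h.hom_X

theorem mul_hom (h : D.IsStepEmbedding x j φ) (a : lowerSubalgebra K D.X j) :
    x j * h.hom a = h.hom (D.σ j a) * x j :=
  mul_deletionFun (D.higher j h.pos) (D.qSkew j h.pos).1 (D.qSkew j h.pos).2.1
    (D.locallyNilpotent j h.pos) (D.iterative j h.pos) h.ne_zero h.mul_apply a

/-- Conjugation by a later variable acts on `A_{j-1}` as `σ_l`. That `σ_l` preserves `A_{j-1}` is
part of the conclusion, hence the witness `b`; both facts are propagated from generators. -/
theorem mul_apply_of_lt (h : D.IsStepEmbedding x j φ) {l : Fin N} (hl : j < l)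
    (a : lowerSubalgebra K D.X j) :
    ∃ b : lowerSubalgebra K D.X j,
      (b : A) = D.σ l ⟨a, lowerSubalgebra_mono D.X (le_of_lt hl) a.2⟩ ∧ x l * φ a = φ b * x l := by
  obtain ⟨a, ha⟩ := a
  refine Algebra.adjoin_induction (p := fun a ha => ∃ b : lowerSubalgebra K D.X j,
      (b : A) = D.σ l ⟨a, lowerSubalgebra_mono D.X (le_of_lt hl) ha⟩ ∧
        x l * φ ⟨a, ha⟩ = φ b * x l) ?_ ?_ ?_ ?_ ha
  · rintro _ ⟨i, hi, rfl⟩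
    refine ⟨D.lam l i • ⟨D.X i, mem_lowerSubalgebra K D.X hi⟩, ?_, ?_⟩
    · rw [D.σ_X l i (lt_trans hi hl), Subalgebra.coe_smul, Subalgebra.coe_smul]
    · rw [map_smul, h.apply_X i hi, h.comm l i hl (lt_trans hi hl), smul_mul_assoc]
  · intro r
    refine ⟨algebraMap K _ r, ?_, ?_⟩
    · have h1 := congrArg Subtype.val ((D.σ l).commutes r)
      rw [Subalgebra.coe_algebraMap] at h1
      rw [Subalgebra.coe_algebraMap]
      exact h1.symm
    · rw [show (⟨algebraMap K A r, _⟩ : lowerSubalgebra K D.X j) = algebraMap K _ r from rfl,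
        AlgHom.commutes, Algebra.commutes]
  · rintro a b ha hb ⟨a', e1, e2⟩ ⟨b', e3, e4⟩
    refine ⟨a' + b', ?_, ?_⟩
    · rw [Subalgebra.coe_add, e1, e3, ← Subalgebra.coe_add, ← map_add]
      rfl
    · rw [show (⟨a + b, _⟩ : lowerSubalgebra K D.X j) = ⟨a, ha⟩ + ⟨b, hb⟩ from rfl, map_add, map_add,
        mul_add, e2, e4, add_mul]
  · rintro a b ha hb ⟨a', e1, e2⟩ ⟨b', e3, e4⟩
    refine ⟨a' * b', ?_, ?_⟩
    · rw [Subalgebra.coe_mul, e1, e3, ← Subalgebra.coe_mul, ← map_mul]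
      rfl
    · rw [show (⟨a * b, _⟩ : lowerSubalgebra K D.X j) = ⟨a, ha⟩ * ⟨b, hb⟩ from rfl, map_mul, map_mul,
        ← mul_assoc, e2, mul_assoc, e4, mul_assoc]

theorem mul_pow_of_lt (h : D.IsStepEmbedding x j φ) {l : Fin N} (hl : j < l) (n : ℕ) :
    x l * x j ^ n = D.lam l j ^ n • (x j ^ n * x l) := by
  induction n with
  | zero => simp
  | succ n ih =>
    rw [pow_succ, ← mul_assoc, ih, smul_mul_assoc, mul_assoc, h.comm l j hl hl, mul_smul_comm,
      smul_smul, ← pow_succ, mul_assoc]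

theorem mul_inv_pow_of_lt (h : D.IsStepEmbedding x j φ) {l : Fin N} (hl : j < l) (n : ℕ) :
    D.lam l j ^ n • (x l * (x j ^ n)⁻¹) = (x j ^ n)⁻¹ * x l := by
  have h0 := pow_ne_zero n h.ne_zero
  rw [eq_inv_mul_iff_mul_eq₀ h0, mul_smul_comm, ← mul_assoc, ← smul_mul_assoc,
    ← h.mul_pow_of_lt hl, mul_inv_cancel_right₀ h0]

/-- This is where the compatibility of `σ_l` with `d_{j,n}` enters. The weight `λ_{l,j}^n` cancels
against that of `x_j^{-n}`, so every term of the deletion formula for `y_i` has the same weight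
`λ_{l,i}`. -/
theorem mul_d_of_lt (h : D.IsStepEmbedding x j φ) {l i : Fin N} (hl : j < l) (hi : i < j) (n : ℕ) :
    x l * φ (D.d j n ⟨D.X i, mem_lowerSubalgebra K D.X hi⟩) =
      (D.lam l j ^ n * D.lam l i) •
        (φ (D.d j n ⟨D.X i, mem_lowerSubalgebra K D.X hi⟩) * x l) := by
  obtain ⟨b, e1, e2⟩ := h.mul_apply_of_lt hl (D.d j n ⟨D.X i, mem_lowerSubalgebra K D.X hi⟩)
  have e3 := D.σ_d j l h.pos hl n ⟨D.X i, mem_lowerSubalgebra K D.X hi⟩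
    (D.lam l i • ⟨D.X i, mem_lowerSubalgebra K D.X hi⟩) (by
      rw [D.σ_X l i (lt_trans hi hl), Subalgebra.coe_smul, Subalgebra.coe_smul])
  have e4 : b = (D.lam l j ^ n * D.lam l i) • D.d j n ⟨D.X i, mem_lowerSubalgebra K D.X hi⟩ := by
    apply Subtype.ext
    rw [e1, e3, map_smul, mul_smul, Subalgebra.coe_smul, Subalgebra.coe_smul, Subalgebra.coe_smul]
  rw [e2, e4, map_smul, smul_mul_assoc]

theorem symm_pow_X {i : Fin N} (hi : i < j) (n : ℕ) :
    ((D.σ j).symm ^ n) ⟨D.X i, mem_lowerSubalgebra K D.X hi⟩ =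
      (D.lam j i ^ n)⁻¹ • ⟨D.X i, mem_lowerSubalgebra K D.X hi⟩ := by
  have h1 : (D.σ j).symm ⟨D.X i, mem_lowerSubalgebra K D.X hi⟩ =
      (D.lam j i)⁻¹ • ⟨D.X i, mem_lowerSubalgebra K D.X hi⟩ := by
    rw [AlgEquiv.symm_apply_eq, map_smul, D.σ_X j i hi, smul_smul,
      inv_mul_cancel₀ (D.lam_ne_zero j i), one_smul]
  induction n with
  | zero => simp
  | succ n ih => rw [pow_succ, AlgEquiv.mul_apply, h1, map_smul, ih, smul_smul, pow_succ', mul_inv]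

theorem deleted_comm (h : D.IsStepEmbedding x j φ) {l i : Fin N} (hl : j ≤ l) (hi : i < l) :
    h.deleted l * h.deleted i =
      D.lam l i • (h.deleted i * h.deleted l) := by
  rw [h.deleted_of_le hl]
  rcases lt_or_ge i j with hij | hij
  · rw [← h.hom_X i hij]
    rcases hl.eq_or_lt with rfl | hl
    · rw [h.mul_hom, D.σ_X j i hij, map_smul, smul_mul_assoc]
    · obtain ⟨m, hm⟩ := D.locallyNilpotent j h.pos ⟨D.X i, mem_lowerSubalgebra K D.X hij⟩
      have e : h.hom ⟨D.X i, mem_lowerSubalgebra K D.X hij⟩ = _ :=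
        deletionFun_eq_sum (D.higher j h.pos) (D.qSkew j h.pos).1 hm
      rw [e, Finset.mul_sum, Finset.sum_mul, Finset.smul_sum]
      refine sum_congr rfl fun n _ => ?_
      rw [symm_pow_X hij, map_smul, map_smul]
      simp only [smul_mul_assoc, mul_smul_comm]
      rw [← mul_assoc, h.mul_d_of_lt hl hij, smul_mul_assoc, mul_assoc, mul_assoc,
        ← h.mul_inv_pow_of_lt hl, mul_smul_comm]
      simp only [smul_smul]
      congr 1
      ring
  · rw [h.deleted_of_le hij, h.comm l i (lt_of_le_of_lt hij hi) hi]

theorem isRightOre (h : D.IsStepEmbedding x j φ) {n : ℕ} (hn : (j : ℕ) < n) :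
    IsRightOre (lowerSubalgebra K x n) (x j) := by
  refine isRightOre_adjoin ?_ ⟨j, hn, rfl⟩
  rintro _ ⟨i, hi, rfl⟩ k
  have hxj := mem_lowerSubalgebra K x hn
  have hxi := mem_lowerSubalgebra K x hi
  rcases lt_trichotomy i j with hij | rfl | hij
  · rw [← h.apply_X i hij]
    exact exists_mul_pow_eq_pow_mul (D.higher j h.pos) (D.qSkew j h.pos).1
      (D.locallyNilpotent j h.pos) (D.iterative j h.pos) h.mul_apply
      (h.range_eq.trans_le (lowerSubalgebra_mono x hn.le)) hxj _ k
  · exact ⟨k, x i, hxj, by rw [← pow_succ, ← pow_succ']⟩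
  · exact ⟨k, D.lam i j ^ k • x i, Subalgebra.smul_mem _ hxi _, by
      rw [h.mul_pow_of_lt hij, mul_smul_comm]⟩

theorem le_rightFractions (h : D.IsStepEmbedding x j φ) {n : ℕ} (hn : (j : ℕ) < n) :
    lowerSubalgebra K h.deleted n ≤
      rightFractions (lowerSubalgebra K x n) (x j) (mem_lowerSubalgebra K x hn)
        (h.isRightOre hn) := by
  rw [lowerSubalgebra, Algebra.adjoin_le_iff]
  rintro _ ⟨i, hi, rfl⟩
  rcases lt_or_ge i j with hij | hij
  · obtain ⟨m, hm⟩ := D.locallyNilpotent j h.pos ⟨D.X i, mem_lowerSubalgebra K D.X hij⟩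
    refine ⟨m, ?_⟩
    have e : h.hom ⟨D.X i, mem_lowerSubalgebra K D.X hij⟩ * x j ^ m = _ :=
      deletionFun_mul_pow (D.higher j h.pos) (D.qSkew j h.pos).1 h.ne_zero
        (fun n hn => hm n hn.le)
    rw [← h.hom_X i hij, e]
    refine Subalgebra.sum_mem _ fun k _ => Subalgebra.mul_mem _ ?_
      (Subalgebra.pow_mem _ (mem_lowerSubalgebra K x hn) _)
    exact h.range_eq.trans_le (lowerSubalgebra_mono x hn.le) ⟨_, rfl⟩
  · refine ⟨0, ?_⟩
    rw [h.deleted_of_le hij, pow_zero, mul_one]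
    exact mem_lowerSubalgebra K x hi

theorem isDeleted (h : D.IsStepEmbedding x j φ) : D.IsDeleted h.deleted j where
  exists_hom := ⟨h.hom, h.hom_injective, h.hom_X⟩
  comm _ _ := h.deleted_comm
  free l hl := by
    rw [h.deleted_of_le hl]
    rcases (show j ≤ l from hl).eq_or_lt with rfl | hl
    · rw [← h.range_hom]
      exact isSkewFree_deletionHom _ _ _ _ _ _ _ h.injective h.free
    -- For `l > j` the element `x_l` is unchanged, but the algebra below it now has the `y_i` as
    -- generators; these are fractions over the old algebra with denominators powers of `x_j`.
    · exact (h.free_of_lt l hl).of_le_rightFractions (mem_lowerSubalgebra K x hl) h.ne_zero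
        (fun a ha => h.le_rightFractions hl ha) (D.lam_ne_zero l j) (h.comm l j hl hl)

end IsStepEmbedding

/-! ### Running the algorithm down to the `T_i`. -/

theorem IsStepEmbedding.transport_eq {x : Fin N → D.Frac} {j : Fin N}
    {φ : lowerSubalgebra K D.X j →ₐ[K] D.Frac} (h : D.IsStepEmbedding x j φ)
    (a : lowerSubalgebra K D.X j) : D.transport x j a = φ a := by
  have hex : ∃ φ : lowerSubalgebra K D.X j →ₐ[K] D.Frac,
      ∀ (i : Fin N) (hi : i < j), φ ⟨D.X i, mem_lowerSubalgebra K D.X hi⟩ = x i :=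
    ⟨φ, h.apply_X⟩
  rw [transport, dif_pos hex]
  refine DFunLike.congr_fun (lowerSubalgebra_hom_ext fun i hi => ?_) a
  rw [hex.choose_spec i hi, h.apply_X i hi]

theorem IsStepEmbedding.deleteStep_eq {x : Fin N → D.Frac} {j : Fin N}
    {φ : lowerSubalgebra K D.X j →ₐ[K] D.Frac} (h : D.IsStepEmbedding x j φ) :
    D.deleteStep j x = h.deleted := by
  ext i
  rw [deleteStep, deleted]
  split_ifs with hi
  · simp only [h.transport_eq]
    rfl
  · rfl

variable (D)

theorem isDeleted_gens (k : ℕ) (hk : k ≤ N - 1) : D.IsDeleted (D.gens k) (N - k) := by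
  induction k with
  | zero =>
    -- At the start no derivation is deleted: the conditions on indices `l ≥ N` are vacuous.
    refine ⟨⟨D.toFrac.comp (lowerSubalgebra K D.X (N - 0)).val,
      D.toFrac_injective.comp Subtype.val_injective, fun i hi => rfl⟩,
      fun l i hl => absurd l.2 (by omega), fun l hl => absurd l.2 (by omega)⟩
  | succ k ih =>
    have ih := ih (by omega)
    have hlt : k + 1 < N := by omega
    have hj : ((stepIndex k hlt : Fin N) : ℕ) = N - (k + 1) := by
      simp only [stepIndex]
      omega
    rw [show N - k = (stepIndex k hlt : ℕ) + 1 by omega] at ih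
    obtain ⟨φ, hφ⟩ := ih.exists_stepEmbedding (by omega)
    rw [gens, dif_pos hlt, ← hj, hφ.deleteStep_eq]
    exact hφ.isDeleted

theorem exists_isStepEmbedding (k : ℕ) (h : k + 1 < N) :
    ∃ (φ : _) (hφ : D.IsStepEmbedding (D.gens k) (stepIndex k h) φ),
      D.gens (k + 1) = hφ.deleted := by
  have H := D.isDeleted_gens k (by omega)
  have hj : ((stepIndex k h : Fin N) : ℕ) = N - 1 - k := rfl
  rw [show N - k = (stepIndex k h : ℕ) + 1 by omega] at H
  obtain ⟨φ, hφ⟩ := H.exists_stepEmbedding (by omega)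
  exact ⟨φ, hφ, by rw [gens, dif_pos h, hφ.deleteStep_eq]⟩

theorem T_injective : Function.Injective D.T := by
  have key : ∀ i l : Fin N, i < l → D.T i ≠ D.T l := by
    intro i l hil he
    -- After the last step, the skew freeness clause covers every `l ≥ 1`, so `T_l` lies outside the
    -- algebra generated by the earlier `T_i`.
    have hN : N - (N - 1) = 1 := by have := l.2; omega
    have H := D.isDeleted_gens (N - 1) le_rfl
    rw [hN] at H
    have he' : D.gens (N - 1) i = D.gens (N - 1) l := congrArg Subtype.val he
    have hl : 1 ≤ (l : ℕ) := by have : (i : ℕ) < l := hil; omega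
    refine (H.free l hl).not_mem ?_
    rw [← he']
    exact mem_lowerSubalgebra K _ hil
  intro i l he
  rcases lt_trichotomy i l with h | h | h
  · exact absurd he (key i l h)
  · exact h
  · exact absurd he.symm (key l i h)

/-! ### The canonical embedding preserves complete primeness -/

theorem stageMk_smul (k : ℕ) (h : k + 1 < N) (c : K) (a : D.stage k) :
    D.stageMk k h (c • a) = c • D.stageMk k h a :=
  rfl

/-- On the algebra of the first deleted generators, `g` inverts the injective deletion map and then
applies `φ` modulo `x_j`. The later generators quasi-commute with the earlier ones and are skew free
over them, so they impose no further condition beyond quasi-commutation in the quotient. -/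
theorem exists_stageQuotient_hom (k : ℕ) (h : k + 1 < N) :
    ∃ g : D.stage (k + 1) →ₐ[K] D.StageQuotient k h,
      ∀ i : Fin N, g (D.stageGen (k + 1) i) = D.stageMk k h (D.stageGen k i) := by
  obtain ⟨φ, hφ, hy⟩ := D.exists_isStepEmbedding k h
  let j := stepIndex k h
  have hle : φ.range ≤ D.stage k := by
    rw [hφ.range_eq, stage, ← lowerSubalgebra_eq_adjoin_range]
    exact lowerSubalgebra_mono _ j.2.le
  let μ : D.stage k →ₐ[K] D.StageQuotient k h :=
    RingCon.mkₐ (α := K) (TwoSidedIdeal.span {D.stageGen k (stepIndex k h)}).ringCon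
  let χ : lowerSubalgebra K D.X j →ₐ[K] D.StageQuotient k h :=
    μ.comp (φ.codRestrict (D.stage k) fun a => hle ⟨a, rfl⟩)
  have hχ : ∀ (i : Fin N) (hi : i < j), χ ⟨D.X i, mem_lowerSubalgebra K D.X hi⟩ =
      D.stageMk k h (D.stageGen k i) := by
    intro i hi
    refine congrArg (D.stageMk k h) (Subtype.ext ?_)
    exact hφ.apply_X i hi
  have hdel := hφ.isDeleted
  rw [← hy] at hdel
  refine exists_algHom_of_graph ?_
  rw [← lowerSubalgebra_eq_adjoin_range]
  refine graph_functional (m := j) (lam := D.lam) hdel.comm ?_ hdel.free ?_ j.2.le le_rfl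
  · intro l i hl hi
    rcases (show j ≤ l from hl).eq_or_lt with hl | hl
    -- For `l = j` the undeleted `x_j` need not quasi-commute with the `x_i`, but its class is zero,
    -- so the relation is trivial in the quotient.
    · have h0 : D.stageMk k h (D.stageGen k l) = 0 := by
        rw [← hl]
        refine (RingCon.eq _).2 ?_
        rw [TwoSidedIdeal.rel_iff, sub_zero]
        exact TwoSidedIdeal.subset_span rfl
      rw [h0, zero_mul, mul_zero, smul_zero]
    · rw [← map_mul, ← map_mul, ← stageMk_smul]
      exact congrArg (D.stageMk k h) (Subtype.ext (hφ.comm l i hl hi))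
  · have hr := lowerSubalgebra_range (x := fun i => (D.gens (k + 1) i,
      D.stageMk k h (D.stageGen k i))) (hφ.hom.prod χ) (fun i hi => by
        refine Prod.ext ?_ (hχ i hi)
        rw [hy]
        exact hφ.hom_X i hi)
    rw [← hr]
    rintro _ ⟨a, rfl⟩ h0
    have ha : a = 0 := (map_eq_zero_iff _ hφ.hom_injective).1 h0
    rw [ha]
    exact map_zero χ

theorem psiStep_mem_CSpec (k : ℕ) (h : k + 1 < N) {P : TwoSidedIdeal (D.stage k)}
    (hP : P ∈ CSpec (D.stage k)) : D.psiStep k h P ∈ CSpec (D.stage (k + 1)) := by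
  obtain ⟨Q, hQ, hQP⟩ : ∃ Q : TwoSidedIdeal (D.stage (k + 1)), Q.IsCompletelyPrime ∧
      (Q : Set (D.stage (k + 1))) = D.psiStepSet k h P := by
    by_cases hx : D.stageGen k (stepIndex k h) ∈ P
    · obtain ⟨g, hg⟩ := D.exists_stageQuotient_hom k h
      obtain ⟨Q, hQ, hQg⟩ := TwoSidedIdeal.IsCompletelyPrime.exists_preimage hP
        (TwoSidedIdeal.span_le.2 (Set.singleton_subset_iff.2 hx)) (g : D.stage (k + 1) →+* _)
      refine ⟨Q, hQ, Set.ext fun a => (hQg a).trans ⟨fun ha => Or.inr ⟨hx, g, hg, ha⟩, ?_⟩⟩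
      rintro (⟨hx', -⟩ | ⟨-, g', hg', ha⟩)
      · exact absurd hx hx'
      -- The homomorphism quantified in `psiStepSet` is determined by its values on generators, so
      -- any choice describes the same set.
      · have e : g = g' := AlgHom.adjoin_ext (by
          rintro _ ⟨i, rfl⟩
          exact (hg i).trans (hg' i).symm)
        rw [e]
        exact ha
    · obtain ⟨φ, hφ, hy⟩ := D.exists_isStepEmbedding k h
      have e0 := lowerSubalgebra_eq_adjoin_range (K := K) (D.gens k)
      have e1 := lowerSubalgebra_eq_adjoin_range (K := K) (D.gens (k + 1))
      have hOre := hφ.isRightOre (stepIndex k h).2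
      have hle := hφ.le_rightFractions (stepIndex k h).2
      rw [← hy] at hle
      have hOre' : IsRightOre (D.stage k) (D.gens k (stepIndex k h)) := by
        rw [stage, ← e0]
        exact hOre
      have hle' : D.stage (k + 1) ≤ rightFractions (D.stage k) (D.gens k (stepIndex k h))
          (D.stageGen k _).2 hOre' := by
        intro z hz
        rw [stage, ← e1] at hz
        obtain ⟨n, hn⟩ := hle hz
        rw [e0] at hn
        exact ⟨n, hn⟩
      obtain ⟨Q, hQ, hQx⟩ := exists_completelyPrime_of_rightFractions (D.stageGen k _).2
        hφ.ne_zero hOre' hle' hP hx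
      refine ⟨Q, hQ, Set.ext fun a => (hQx a).trans ⟨fun ha => Or.inl ⟨hx, ha⟩, ?_⟩⟩
      rintro (⟨-, ha⟩ | ⟨hx', -⟩)
      · exact ha
      · exact absurd hx' hx
  have hex : ∃ Q : TwoSidedIdeal (D.stage (k + 1)),
      (Q : Set (D.stage (k + 1))) = D.psiStepSet k h P := ⟨Q, hQP⟩
  rw [psiStep, dif_pos hex]
  -- A two-sided ideal is determined by its underlying set, so the chosen ideal is `Q` and the
  -- default `⊤` never occurs.
  have e : hex.choose = Q := SetLike.coe_injective (hex.choose_spec.trans hQP.symm)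
  rw [e]
  exact hQ

theorem toStageZero_bijective : Function.Bijective D.toStageZero := by
  refine ⟨fun a b hab => D.toFrac_injective (congrArg Subtype.val hab), ?_⟩
  have hle : D.stage 0 ≤ D.toFrac.range := by
    rw [stage, Algebra.adjoin_le_iff]
    rintro _ ⟨i, rfl⟩
    exact ⟨D.X i, rfl⟩
  rintro ⟨z, hz⟩
  obtain ⟨a, ha⟩ := hle hz
  exact ⟨a, Subtype.ext ha⟩

theorem psiAux_mem_CSpec {P : TwoSidedIdeal A} (hP : P ∈ CSpec A) (k : ℕ) (hk : k ≤ N - 1) :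
    D.psiAux P k hk ∈ CSpec (D.stage k) := by
  induction k with
  | zero =>
    exact TwoSidedIdeal.IsCompletelyPrime.map_of_bijective hP (D.toStageZero : A →+* D.stage 0)
      D.toStageZero_bijective
  | succ k ih => exact D.psiStep_mem_CSpec k (by omega) (ih (by omega))

end QuantumNilpotent

/-- The canonical partition of the completely prime spectrum of a quantum nilpotent algebra. -/
theorem theorem3p7 {K : Type*} [Field K] {N : ℕ} {A : Type*} [Ring A] [Algebra K A]
    (D : QuantumNilpotent K N A) :
    (∀ P ∈ CSpec A, D.psi P ∈ CSpec D.A') ∧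
    CSpec A = ⋃ w ∈ D.cauchonDiagrams, D.stratum w ∧
    (∀ w ∈ D.cauchonDiagrams, (D.stratum w).Nonempty) ∧
    D.cauchonDiagrams.PairwiseDisjoint D.stratum ∧
    D.cauchonDiagrams.ncard ≤ Nat.card (Finset (Fin N)) ∧
    Nat.card (Finset (Fin N)) = 2 ^ N := by
  have hpsi : ∀ P ∈ CSpec A, D.psi P ∈ CSpec D.A' := fun P hP =>
    D.psiAux_mem_CSpec hP (N - 1) le_rfl
  refine ⟨hpsi, ?_, fun w hw => hw, ?_, ?_, by simp⟩
  · ext P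
    simp only [Set.mem_iUnion]
    constructor
    · intro hP
      classical
      let w : Finset (Fin N) := {i | D.T i ∈ D.psi P}
      have hw : P ∈ D.stratum w := by
        refine ⟨hP, hpsi P hP, ?_⟩
        ext a
        constructor
        · rintro ⟨ha, i, rfl⟩
          exact ⟨i, by simpa [w] using ha, rfl⟩
        · rintro ⟨i, hi, rfl⟩
          exact ⟨by simpa [w] using hi, i, rfl⟩
      exact ⟨w, ⟨P, hw⟩, hw⟩
    · rintro ⟨w, -, hw⟩
      exact hw.1
  · intro w _ w' _ hne
    refine Set.disjoint_left.2 fun P h1 h2 => hne ?_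
    have e := h1.2.2.symm.trans h2.2.2
    -- `P` determines the set of those `T_i` that lie in `ψ(P)`; injectivity of `T` recovers the
    -- index set from it.
    exact Finset.coe_injective (Set.image_injective.2 D.T_injective e)
  · rw [← Set.ncard_univ]
    exact Set.ncard_le_ncard (Set.subset_univ _)
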